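/- **Setting.** Let $D\subseteq\mathbb R$ be a Borel set, $K:D\times D\to\mathbb R$ a measurable reproducing kernel with anchor $c\in D$, i.e. $K(c,c)=0$, and $\rho$ a probability measure on $D$ with $M:=\int_D K(x,x)\,\rho(dx)<\infty$ and $C_0:=\int_D\int_D K(x,y)\,\rho(dx)\rho(dy)>0$. Let $\mathcal U$ be the set of finite subsets of $\mathbb N$, and $K_u(\mathbf x,\mathbf y)=\prod_{j\in u}K(x_j,y_j)$ for $u\in\mathcal U$, with reproducing kernel Hilbert space $H_u$. Let $\boldsymbol\gamma=(\gamma_u)_{u\in\mathcal U}$ be non-negative weights with $\sum_u\gamma_uM^{|u|}<\infty$, let $\mathfrak X=\{\mathbf x\in D^{\mathbb N}:\sum_u\gamma_uK_u(\mathbf x,\mathbf x)<\infty\}$, let $\mathcal H_{\boldsymbol\gamma}$ be the reproducing kernel Hilbert space on $\mathfrak X$ with kernel $\sum_u\gamma_uK_u$, and let $I(f)=\int f\,d\mu$ with $\mu=\rho^{\otimes\mathbb N}$. For $v\in\mathcal U$ let $(\mathbf x_v;\mathbf c)$ be the point with coordinates $x_j$ for $j\in v$ and $c$ for $j\notin v$.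 Algorithms are $Q(f)=\sum_{i=1}^n a_if(\mathbf x^{(i)})$, $n\ge 0$, where each $\mathbf x^{(i)}$ has only finitely many coordinates different from $c$. Put $e(Q;\mathcal H_{\boldsymbol\gamma})=\sup_{\|f\|\le1}|I(f)-Q(f)|$ and $e((Q)_u;H_u)=\sup_{\|g\|_{H_u}\le1}|I(g)-Q(g)|$. Let $\$:\mathbb N_0\to[1,\infty)$ be non-decreasing. The nested cost $\mathrm{cost}_{\rm nes}(Q)$ is the infimum, over all strictly increasing sequences $w_1\subset w_2\subset\cdots$ in $\mathcal U$, of $\sum_{i=1}^n\inf\{\$(|w_l|): x^{(i)}_j=c\ \forall j\notin w_l\}$. The exponent $p^{\rm nes}$ is the infimum of all $p\ge0$ for which there is a constant $C\ge 0$ with $\inf\{\mathrm{cost}_{\rm nes}(Q): e(Q;\mathcal H_{\boldsymbol\gamma})\le\varepsilon\}\le C\varepsilon^{-p}$ for all $\varepsilon>0$. For $\sigma\in\mathbb N\cup\{\infty\}$ list the non-empty $u\in\mathcal U$ with $|u|\le\sigma$ and $\gamma_u>0$ as $u_1,u_2,\dots$ so that $\widehat\gamma_u:=\gamma_uC_0^{|u|}$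 is non-increasing along the list, and let $\mathrm{decay}_{\boldsymbol\gamma,\sigma}\in[-\infty,\infty]$ be the supremum of all $p\in\mathbb R$ with $\widehat\gamma_{u_j}j^p\to0$ (it is $\infty$ if the list is finite). **Assumptions.** (i) $\$(k)=O(k^s)$ for some $s\ge0$. (ii) $\gamma_u=\Gamma_{|u|}\prod_{j\in u}\gamma_j$ with $\gamma_1\ge\gamma_2\ge\cdots\ge0$, $\Gamma_0=\Gamma_1=1$, $\Gamma_k\ge0$ (POD weights), $\delta:=\mathrm{decay}_{\boldsymbol\gamma,1}>1$, and there are $q<\delta$ and $C_q>0$ with $\Gamma_k\le C_q(k!)^q$ for all $k\in\mathbb N$. (iii) $L\in\mathbb N$, $a>1$, $L_0=0$, $L_k=L\lceil a^{k-1}\rceil$ for $k\ge1$, $v_k=\{1,\dots,L_k\}$. (iv) $\alpha\ge1/2$. Call $\tau$ admissible if $\tau=\tfrac12$ in the case $\alpha=\tfrac12$, and if $\tau\in[\tfrac12,\min\{\alpha,\mathrm{decay}_{\boldsymbol\gamma,\infty}/2\})$ in the case $\alpha>\tfrac12$. We assume that there are admissible $\tau$ (namely $\tau=\tfrac12$ if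 $\alpha=\tfrac12$; arbitrarily close to $\min\{\alpha,\mathrm{decay}_{\boldsymbol\gamma,\infty}/2\}$ if $\alpha>\tfrac12$) with the following property: there is a constant $C_\tau>0$ such that for all $k,n\in\mathbb N$ there is a quadrature $Q_{v_k}$ with $n$ sample points, all of the form $(\mathbf t_{v_k};\mathbf c)$, satisfying $$\sum_{\ell\in u\subseteq\{1,\dots,\ell\}}\gamma_u\,e((Q_{v_k})_u;H_u)^2\le\Big(\sum_{\ell\in u\subseteq\{1,\dots,\ell\}}\gamma_u^{1/(2\tau)}C_\tau^{|u|}\Big)^{2\tau}n^{-2\tau}\qquad\text{for all }\ell\in v_k\setminus v_{k-1}.\tag{$*$}$$ **Conclusion.** Let $b$ be given by * $b=\max\{1/\alpha,\;2s/(\delta-1)\}$ if $s\ge(2\alpha-1)/(2\alpha)$; * if $0\le s<(2\alpha-1)/(2\alpha)$: $b=1/\alpha$ for $\delta\ge2\alpha$; $b=2/\delta$ for $2\alpha>\delta>1/(1-s)$; $b=2s/(\delta-1)$ for $1/(1-s)\ge\delta>1$ (with $2s/(\delta-1)=0$ if $\delta=\infty$). Then $p^{\rm nes}\le b$, and this bound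 is established by the multilevel algorithms $$Q^{\rm ML}_m(f)=f(\mathbf c)+\sum_{k=1}^mQ_{v_k}\big(f-f((\cdot)_{v_{k-1}};\mathbf c)\big),\qquad v_0=\emptyset .$$ That is, for every $p>b$ there are an admissible $\tau$ with the above property, with constant $C_\tau$, and a constant $B$ such that for every $\varepsilon\in(0,1]$ there are $m$ and $n_1\ge\cdots\ge n_m\ge1$ for which every $Q^{\rm ML}_m$ built from quadratures $Q_{v_k}$ with $n_k$ points that satisfy $(*)$ has $e(Q^{\rm ML}_m;\mathcal H_{\boldsymbol\gamma})\le\varepsilon$ and $\mathrm{cost}_{\rm nes}(Q^{\rm ML}_m)\le B\varepsilon^{-p}$. -/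

import Mathlib

open MeasureTheory Filter Asymptotics
open scoped NNReal ENNReal Topology

noncomputable section

/-! ### Scalar reproducing kernels and their Hilbert spaces -/

/-- A real reproducing kernel on `X`: a symmetric positive semidefinite function of two
variables. -/
structure ScalarKernel (X : Type) where
  toFun : X → X → ℝ
  posSemidef : (Matrix.of toFun).PosSemidef

namespace ScalarKernel

instance {X : Type} : CoeFun (ScalarKernel X) (fun _ => X → X → ℝ) := ⟨ScalarKernel.toFun⟩

variable {X : Type}

/-- The same kernel with values in the bounded operators on `ℝ`. -/
def opMatrix (k : ScalarKernel X) : Matrix X X (ℝ →L[ℝ] ℝ) :=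
  Matrix.of fun x y => k x y • ContinuousLinearMap.id ℝ ℝ

theorem symm (k : ScalarKernel X) (x y : X) : k x y = k y x := by
  have := k.posSemidef.1.apply y x
  simpa using this

theorem sum_nonneg (k : ScalarKernel X) (f : X →₀ ℝ) :
    0 ≤ f.sum fun x a => f.sum fun y b => a * k x y * b := by
  simpa using k.posSemidef.2 f

theorem opMatrix_posSemidef (k : ScalarKernel X) : k.opMatrix.PosSemidef := by
  have key : k.opMatrix.IsHermitian ∧ ∀ f : X →₀ ℝ, 0 ≤ RCLike.re
      (f.sum fun x w => f.sum fun x' w' => inner ℝ (k.opMatrix x' x w) w') := by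
    refine ⟨?_, fun f => ?_⟩
    · ext x y
      have hid : star (ContinuousLinearMap.id ℝ ℝ) = ContinuousLinearMap.id ℝ ℝ :=
        star_one (ℝ →L[ℝ] ℝ)
      simp [opMatrix, Matrix.conjTranspose_apply, k.symm x y, hid]
    · have h := k.sum_nonneg f
      simp only [RCLike.re_to_real]
      refine h.trans_eq (Finsupp.sum_congr fun x _ => Finsupp.sum_congr fun y _ => ?_)
      simp [opMatrix, k.symm x y]
      ring
  exact (RKHS.posSemidef_tfae.out 0 2).mpr key

instance (k : ScalarKernel X) : Fact k.opMatrix.PosSemidef := ⟨k.opMatrix_posSemidef⟩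

/-- The reproducing kernel Hilbert space `H(k)` of functions on `X`. -/
abbrev Space (k : ScalarKernel X) : Type := RKHS.OfKernel k.opMatrix

theorem two_mul_abs_le_diag (k : ScalarKernel X) (x y : X) : 2 * |k x y| ≤ k x x + k y y := by
  have h := (Matrix.posSemidef_iff_dotProduct_mulVec.mp (k.posSemidef.submatrix ![x, y])).2
  have h1 := h ![1, 1]
  have h2 := h ![1, -1]
  simp [Matrix.mulVec, dotProduct, Fin.sum_univ_two] at h1 h2
  rw [k.symm y x] at h1 h2
  rcases abs_cases (k x y) with h | h <;> linarith

theorem diag_nonneg (k : ScalarKernel X) (x : X) : 0 ≤ k x x := by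
  have := k.two_mul_abs_le_diag x x
  have := abs_nonneg (k x x)
  linarith

end ScalarKernel

/-! ### The weighted space of functions of infinitely many variables

Coordinates are numbered from `0`, so that the set `[d]` of the first `d` coordinates is
`Finset.range d`.  A family of weights is a function `γ : Finset ℕ → ℝ≥0`. -/

section Spaces

variable {E : Type}

theorem posSemidef_prodKernel (K : ScalarKernel E) (u : Finset ℕ) :
    (Matrix.of fun x y : ℕ → E => ∏ j ∈ u, K (x j) (y j)).PosSemidef := by
  classical
  induction u using Finset.induction_on with
  | empty =>
    refine ⟨by ext; simp [Matrix.conjTranspose_apply], fun f => ?_⟩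
    have : (f.sum fun i xi => f.sum fun j xj => star xi *
        (Matrix.of fun x y : ℕ → E => ∏ j ∈ (∅ : Finset ℕ), K (x j) (y j)) i j * xj)
        = (f.sum fun _ a => a) * (f.sum fun _ a => a) := by
      simp [Finsupp.sum, Finset.sum_mul_sum]
    rw [this]
    exact mul_self_nonneg _
  | insert a s ha ih =>
    have h : (Matrix.of fun x y : ℕ → E => ∏ j ∈ insert a s, K (x j) (y j))
        = Matrix.hadamard ((Matrix.of K.toFun).submatrix (fun x : ℕ → E => x a) fun x => x a)
          (Matrix.of fun x y : ℕ → E => ∏ j ∈ s, K (x j) (y j)) := by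
      ext x y
      simp [Finset.prod_insert ha, Matrix.hadamard]
    rw [h]
    exact (K.posSemidef.submatrix (fun x : ℕ → E => x a)).hadamard ih

/-- The kernel `K_u(x, y) = ∏_{j ∈ u} K(x_j, y_j)` on `E^ℕ`. -/
def prodKernel (K : ScalarKernel E) (u : Finset ℕ) : ScalarKernel (ℕ → E) :=
  ⟨fun x y => ∏ j ∈ u, K (x j) (y j), posSemidef_prodKernel K u⟩

/-- The domain `𝔛` of the functions of infinitely many variables. -/
def weightedDomain (K : ScalarKernel E) (γ : Finset ℕ → ℝ≥0) : Set (ℕ → E) :=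
  {x | Summable fun u : Finset ℕ => (γ u : ℝ) * ∏ j ∈ u, K (x j) (x j)}

theorem summable_weightedKernel (K : ScalarKernel E) (γ : Finset ℕ → ℝ≥0)
    (x y : weightedDomain K γ) :
    Summable fun u : Finset ℕ => (γ u : ℝ) * prodKernel K u x y := by
  refine Summable.of_norm_bounded (x.2.add y.2) fun u => ?_
  have h := (prodKernel K u).two_mul_abs_le_diag x y
  have h0 := abs_nonneg (prodKernel K u x y)
  rw [norm_mul, Real.norm_eq_abs, Real.norm_eq_abs, NNReal.abs_eq, ← mul_add]
  refine mul_le_mul_of_nonneg_left ?_ (γ u).2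
  change _ ≤ prodKernel K u x x + prodKernel K u y y
  linarith

/-- The kernel `𝒦_γ = ∑_u γ_u K_u` on `𝔛` (coordinate sets with `γ_u = 0` contribute nothing). -/
def weightedKernel (K : ScalarKernel E) (γ : Finset ℕ → ℝ≥0) :
    ScalarKernel (weightedDomain K γ) where
  toFun x y := ∑' u : Finset ℕ, (γ u : ℝ) * prodKernel K u x y
  posSemidef := by
    refine ⟨?_, fun f => ?_⟩
    · ext x y
      simp only [Matrix.conjTranspose_apply, Matrix.of_apply, star_trivial]
      exact tsum_congr fun u => by rw [(prodKernel K u).symm]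
    · simp only [Finsupp.sum, Matrix.of_apply, star_trivial]
      have hs : ∀ x ∈ f.support, ∀ y ∈ f.support, Summable fun u : Finset ℕ =>
          f x * ((γ u : ℝ) * prodKernel K u x y) * f y := fun x _ y _ =>
        ((summable_weightedKernel K γ x y).mul_left _).mul_right _
      have : (∑ x ∈ f.support, ∑ y ∈ f.support,
          f x * (∑' u : Finset ℕ, (γ u : ℝ) * prodKernel K u x y) * f y)
          = ∑' u : Finset ℕ, ∑ x ∈ f.support, ∑ y ∈ f.support,
            f x * ((γ u : ℝ) * prodKernel K u x y) * f y := by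
        rw [Summable.tsum_finsetSum fun x hx => summable_sum fun y hy => hs x hx y hy]
        refine Finset.sum_congr rfl fun x hx => ?_
        rw [Summable.tsum_finsetSum fun y hy => hs x hx y hy]
        refine Finset.sum_congr rfl fun y _ => ?_
        rw [tsum_mul_right, tsum_mul_left]
      rw [this]
      refine tsum_nonneg fun u => ?_
      have h := ((prodKernel K u).posSemidef.submatrix
        (Subtype.val : weightedDomain K γ → ℕ → E)).2 f
      simp only [Finsupp.sum, Matrix.submatrix_apply, Matrix.of_apply, star_trivial] at h
      refine (mul_nonneg (γ u).2 h).trans_eq ?_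
      rw [Finset.mul_sum]
      refine Finset.sum_congr rfl fun x _ => ?_
      rw [Finset.mul_sum]
      refine Finset.sum_congr rfl fun y _ => ?_
      simp only [NNReal.val_eq_coe]
      ring

end Spaces

/-! ### Algorithms and worst case errors -/

section Algorithms

variable {E : Type}

/-- A linear algorithm `Q(f) = ∑_i a_i f(x_i)`, as the list of its pairs `(a_i, x_i)`. -/
abbrev SamplingRule (E : Type) : Type := List (ℝ × (ℕ → E))

/-- The value `Q(f)`. -/
def SamplingRule.eval (Q : SamplingRule E) (f : (ℕ → E) → ℝ) : ℝ :=
  (Q.map fun p => p.1 * f p.2).sum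

/-- All sample points are of the form `(t_v; c)` with a finite coordinate set `v`. -/
def SamplingRule.Admissible (c : E) (Q : SamplingRule E) : Prop :=
  ∀ p ∈ Q, {j | p.2 j ≠ c}.Finite

/-- The point `(x_v; c)`. -/
def anchorOutside (c : E) (v : Finset ℕ) (x : ℕ → E) : ℕ → E :=
  fun j => if j ∈ v then x j else c

theorem mem_weightedDomain_of_finite (K : ScalarKernel E) (γ : Finset ℕ → ℝ≥0) {c : E}
    (hc : K c c = 0) {x : ℕ → E} (hx : {j | x j ≠ c}.Finite) : x ∈ weightedDomain K γ := by
  refine summable_of_ne_finset_zero (s := hx.toFinset.powerset) fun u hu => ?_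
  obtain ⟨j, hj, hjx⟩ := Finset.not_subset.mp (fun h => hu (Finset.mem_powerset.mpr h))
  have hxj : x j = c := by simpa using hjx
  rw [Finset.prod_eq_zero hj (by rw [hxj, hc]), mul_zero]

variable [MeasurableSpace E]

/-- The constant `M = ∫ K(x, x) ρ(dx)`. -/
def diagonalConstant (K : ScalarKernel E) (ρ : Measure E) : ℝ := ∫ x, K x x ∂ρ

/-- The constant `C₀ = ∫∫ K(x, y) ρ(dx) ρ(dy)`. -/
def meanConstant (K : ScalarKernel E) (ρ : Measure E) : ℝ := ∫ y, ∫ x, K x y ∂ρ ∂ρ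

/-- Integration with respect to the infinite product of `ρ`. -/
def integralFunctional (ρ : Measure E) (f : (ℕ → E) → ℝ) : ℝ :=
  ∫ x, f x ∂(Measure.infinitePi fun _ : ℕ => ρ)

/-- The worst case error `e(Q; ℋ_γ)`.  Functions on `𝔛` are extended by `0`; this changes neither
the integral over `𝔛` nor the values at admissible points, which all lie in `𝔛`. -/
def worstCaseError (K : ScalarKernel E) (ρ : Measure E) (γ : Finset ℕ → ℝ≥0)
    (Q : SamplingRule E) : ℝ≥0∞ :=
  ⨆ (f : (weightedKernel K γ).Space) (_ : ‖f‖ ≤ 1),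
    ENNReal.ofReal |integralFunctional ρ (Function.extend Subtype.val (⇑f) 0)
      - Q.eval (Function.extend Subtype.val (⇑f) 0)|

/-- The worst case error `e((Q)_u; H_u)` on the space `H_u` with kernel `K_u`, whose elements are
functions on `E^ℕ` that depend only on the coordinates in `u`. -/
def componentError (K : ScalarKernel E) (ρ : Measure E) (u : Finset ℕ)
    (Q : SamplingRule E) : ℝ≥0∞ :=
  ⨆ (g : (prodKernel K u).Space) (_ : ‖g‖ ≤ 1),
    ENNReal.ofReal |integralFunctional ρ (⇑g) - Q.eval (⇑g)|

end Algorithms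

/-! ### Cost, complexity and the exponent of strong tractability -/

section Cost

variable {E : Type}

/-- Cost of a function evaluation at `x` for the nested sequence `w`. -/
def pointCost (cost : ℕ → ℝ) (c : E) (w : ℕ → Finset ℕ) (x : ℕ → E) : ℝ≥0∞ :=
  ⨅ (i : ℕ) (_ : ∀ j ∉ w i, x j = c), ENNReal.ofReal (cost (w i).card)

/-- Cost of an algorithm in the nested subspace sampling model. -/
def nestedCost (cost : ℕ → ℝ) (c : E) (Q : SamplingRule E) : ℝ≥0∞ :=
  ⨅ (w : ℕ → Finset ℕ) (_ : StrictMono w), (Q.map fun p => pointCost cost c w p.2).sum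

variable [MeasurableSpace E]

/-- The `ε`-complexity in the nested subspace sampling model. -/
def nestedComplexity (cost : ℕ → ℝ) (c : E) (K : ScalarKernel E) (ρ : Measure E)
    (γ : Finset ℕ → ℝ≥0) (ε : ℝ) : ℝ≥0∞ :=
  ⨅ (Q : SamplingRule E) (_ : Q.Admissible c ∧ worstCaseError K ρ γ Q ≤ ENNReal.ofReal ε),
    nestedCost cost c Q

/-- The exponent of strong tractability `p^nes` (`⊤` if the problem is not strongly tractable). -/
def nestedExponent (cost : ℕ → ℝ) (c : E) (K : ScalarKernel E) (ρ : Measure E)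
    (γ : Finset ℕ → ℝ≥0) : EReal :=
  ⨅ (p : ℝ) (_ : 0 ≤ p ∧ ∃ C : ℝ, 0 ≤ C ∧ ∀ ε : ℝ, 0 < ε →
    nestedComplexity cost c K ρ γ ε ≤ ENNReal.ofReal (C * ε ^ (-p))), (p : EReal)

end Cost

/-! ### Weights -/

/-- The cut-off weights `γ^(σ)`. -/
def cutoffWeights (γ : Finset ℕ → ℝ≥0) (σ : ℕ∞) (u : Finset ℕ) : ℝ≥0 :=
  if (u.card : ℕ∞) ≤ σ then γ u else 0

/-- The `(j+1)`-st largest value of `w` on the set `A`, counted with multiplicity; it is `0` if `A`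
has at most `j` elements. -/
def sortedValue (A : Set (Finset ℕ)) (w : Finset ℕ → ℝ) (j : ℕ) : ℝ :=
  sSup {t : ℝ | ∃ F : Finset (Finset ℕ), F.card = j + 1 ∧ ∀ u ∈ F, u ∈ A ∧ t ≤ w u}

/-- If `u_0, u_1, …` enumerates `A` with `w(u_0) ≥ w(u_1) ≥ …`, then `sortedValue A w j` is
`w(u_j)`. -/
theorem sortedValue_eq {A : Set (Finset ℕ)} {w : Finset ℕ → ℝ} {u : ℕ → Finset ℕ}
    (hu : Set.BijOn u Set.univ A) (hw : Antitone (w ∘ u)) (j : ℕ) :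
    sortedValue A w j = w (u j) := by
  classical
  have hinj : Function.Injective u := Set.injOn_univ.mp hu.injOn
  refine IsGreatest.csSup_eq ⟨⟨(Finset.range (j + 1)).image u, ?_, ?_⟩, ?_⟩
  · rw [Finset.card_image_of_injective _ hinj, Finset.card_range]
  · intro v hv
    obtain ⟨i, hi, rfl⟩ := Finset.mem_image.mp hv
    exact ⟨hu.mapsTo (Set.mem_univ i), hw (Nat.lt_succ_iff.mp (Finset.mem_range.mp hi))⟩
  · rintro t ⟨F, hF, hFt⟩
    obtain ⟨v, hv, hvj⟩ : ∃ v ∈ F, v ∉ (Finset.range j).image u := by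
      by_contra! hcon
      have h1 := Finset.card_le_card (show F ⊆ (Finset.range j).image u from hcon)
      have h2 := Finset.card_image_le (s := Finset.range j) (f := u)
      rw [Finset.card_range] at h2
      omega
    obtain ⟨i, -, rfl⟩ := hu.surjOn (hFt v hv).1
    have hij : j ≤ i := by
      by_contra! hlt
      exact hvj (Finset.mem_image.mpr ⟨i, Finset.mem_range.mpr hlt, rfl⟩)
    exact (hFt _ hv).2.trans (hw hij)

/-- `decay_{γ,σ}`: the supremum of all real `p` with `γ̂_{u_j(σ)} j^p → 0`, where
`γ̂_u = γ_u C₀^{|u|}` and `u_1(σ), u_2(σ), …` are the non-empty sets with `γ_u^(σ) > 0`, ordered by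
decreasing `γ̂_u`. -/
def decay (C₀ : ℝ) (γ : Finset ℕ → ℝ≥0) (σ : ℕ∞) : EReal :=
  ⨆ (p : ℝ) (_ : Tendsto (fun j : ℕ =>
    sortedValue {u | u.Nonempty ∧ 0 < cutoffWeights γ σ u}
      (fun u => (cutoffWeights γ σ u : ℝ) * C₀ ^ u.card) j * ((j : ℝ) + 1) ^ p) atTop (𝓝 0)),
    (p : EReal)

/-- Product and order-dependent weights `γ_u = Γ_{|u|} ∏_{j ∈ u} γ_j`. -/
def podWeights (Γ g : ℕ → ℝ≥0) (u : Finset ℕ) : ℝ≥0 := Γ u.card * ∏ j ∈ u, g j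

/-! ### Multilevel algorithms -/

/-- `L_0 = 0` and `L_k = L ⌈a^(k-1)⌉` for `k ≥ 1`. -/
def levelDim (L : ℕ) (a : ℝ) : ℕ → ℕ
  | 0 => 0
  | k + 1 => L * ⌈a ^ k⌉₊

/-- The coordinate sets `v_k = [L_k]`. -/
def levelSet (L : ℕ) (a : ℝ) (k : ℕ) : Finset ℕ := Finset.range (levelDim L a k)

section Multilevel

variable {E : Type}

/-- The multilevel algorithm
`Q^ML_m(f) = f(c) + ∑_{k=1}^m Q_{v_k}(f - Ψ_{v_{k-1}} f)`, `(Ψ_v f)(x) = f(x_v; c)`. -/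
def multilevelRule (c : E) (L : ℕ) (a : ℝ) (Q : ℕ → SamplingRule E) (m : ℕ) : SamplingRule E :=
  (1, fun _ => c) :: (List.range m).flatMap fun k =>
    Q (k + 1) ++ (Q (k + 1)).map fun p => (-p.1, anchorOutside c (levelSet L a k) p.2)

theorem multilevelRule_eval (c : E) (L : ℕ) (a : ℝ) (Q : ℕ → SamplingRule E) (m : ℕ)
    (f : (ℕ → E) → ℝ) :
    (multilevelRule c L a Q m).eval f = f (fun _ => c) + ∑ k ∈ Finset.range m,
      (Q (k + 1)).eval fun x => f x - f (anchorOutside c (levelSet L a k) x) := by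
  have h : ∀ (R : SamplingRule E) (v : Finset ℕ),
      SamplingRule.eval (R ++ R.map fun p => (-p.1, anchorOutside c v p.2)) f
        = R.eval fun x => f x - f (anchorOutside c v x) := by
    intro R v
    induction R with
    | nil => simp [SamplingRule.eval]
    | cons p R ih =>
      simp only [SamplingRule.eval, List.map_append, List.sum_append, List.map_cons,
        List.sum_cons, List.map_map] at ih ⊢
      linarith
  induction m with
  | zero => simp [multilevelRule, SamplingRule.eval]
  | succ m ih =>
    rw [Finset.sum_range_succ, ← h, ← add_assoc, ← ih]
    simp [multilevelRule, List.range_succ, SamplingRule.eval, add_assoc]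

variable [MeasurableSpace E]

/-- `Q` is a quadrature with `n` sample points in `(E^{v_k}; c)` that satisfies
`∑_{ℓ ∈ u ⊆ [ℓ]} γ_u e((Q)_u; H_u)² ≤ (∑_{ℓ ∈ u ⊆ [ℓ]} γ_u^{1/(2τ)} C^{|u|})^{2τ} n^{-2τ}`
for all `ℓ ∈ v_k \ v_{k-1}`.  (With numbering from `0`, the sets with `ℓ ∈ u ⊆ [ℓ]` are those with
largest element `ℓ`.) -/
def IsLevelQuadrature (c : E) (K : ScalarKernel E) (ρ : Measure E) (γ : Finset ℕ → ℝ≥0)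
    (L : ℕ) (a τ C : ℝ) (k n : ℕ) (Q : SamplingRule E) : Prop :=
  Q.length = n ∧ (∀ p ∈ Q, ∀ j ∉ levelSet L a k, p.2 j = c) ∧
  ∀ ℓ ∈ levelSet L a k \ levelSet L a (k - 1),
    ∑ u ∈ (Finset.range (ℓ + 1)).powerset with ℓ ∈ u, (γ u : ℝ≥0∞) * componentError K ρ u Q ^ 2 ≤
      ENNReal.ofReal ((∑ u ∈ (Finset.range (ℓ + 1)).powerset with ℓ ∈ u,
        (γ u : ℝ) ^ (1 / (2 * τ)) * C ^ u.card) ^ (2 * τ) * (n : ℝ) ^ (-(2 * τ)))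

/-- On every level `k` and for every number `n` of sample points there is a level quadrature with
parameter `τ` and a constant `C` independent of `k` and `n`. -/
def HasLevelQuadratures (c : E) (K : ScalarKernel E) (ρ : Measure E) (γ : Finset ℕ → ℝ≥0)
    (L : ℕ) (a τ C : ℝ) : Prop :=
  0 < C ∧ ∀ k n : ℕ, 1 ≤ k → 1 ≤ n → ∃ Q, IsLevelQuadrature c K ρ γ L a τ C k n Q

/-- `τ = 1/2` if `α = 1/2`, and `τ ∈ [1/2, min{α, δ/2})` if `α > 1/2`. -/
def AdmissibleTau (α : ℝ) (δ : EReal) (τ : ℝ) : Prop :=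
  (α = 1 / 2 ∧ τ = 1 / 2) ∨
    (1 / 2 < α ∧ 1 / 2 ≤ τ ∧ τ < α ∧ ((2 * τ : ℝ) : EReal) < δ)

/-- The weighted error bound with parameter `α`: level quadratures exist for admissible `τ`
arbitrarily close to `min{α, δ/2}`, with a constant that may depend on `τ`
(for `τ = 1/2` if `α = 1/2`). -/
def WeightedErrorBound (c : E) (K : ScalarKernel E) (ρ : Measure E) (γ : Finset ℕ → ℝ≥0)
    (L : ℕ) (a α : ℝ) (δ : EReal) : Prop :=
  ∀ t : ℝ, t < α → ((2 * t : ℝ) : EReal) < δ →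
    ∃ τ, t < τ ∧ AdmissibleTau α δ τ ∧ ∃ C, HasLevelQuadratures c K ρ γ L a τ C

/-- Multilevel algorithms achieve worst case error `ε` at nested cost `O(ε^{-p})`: for a suitable
`τ` for which level quadratures exist, numbers `m` and `n_1 ≥ n_2 ≥ … ≥ n_m ≥ 1` can be chosen for
each `ε` such that the multilevel algorithm built from any level quadratures with these numbers of
points does so. -/
def MultilevelAchieves (cost : ℕ → ℝ) (c : E) (K : ScalarKernel E) (ρ : Measure E)
    (γ : Finset ℕ → ℝ≥0) (L : ℕ) (a α : ℝ) (δ : EReal) (p : ℝ) : Prop :=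
  ∃ τ C, AdmissibleTau α δ τ ∧ HasLevelQuadratures c K ρ γ L a τ C ∧
    ∃ B : ℝ, ∀ ε : ℝ, 0 < ε → ε ≤ 1 → ∃ (m : ℕ) (n : ℕ → ℕ),
      AntitoneOn n (Set.Icc 1 m) ∧ (∀ k ∈ Set.Icc 1 m, 1 ≤ n k) ∧
      ∀ Q : ℕ → SamplingRule E,
        (∀ k ∈ Set.Icc 1 m, IsLevelQuadrature c K ρ γ L a τ C k (n k) (Q k)) →
        worstCaseError K ρ γ (multilevelRule c L a Q m) ≤ ENNReal.ofReal ε ∧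
        nestedCost cost c (multilevelRule c L a Q m) ≤ ENNReal.ofReal (B * ε ^ (-p))

/-- Multilevel algorithms establish the bound `p^nes ≤ b`. -/
def MultilevelEstablishes (cost : ℕ → ℝ) (c : E) (K : ScalarKernel E) (ρ : Measure E)
    (γ : Finset ℕ → ℝ≥0) (L : ℕ) (a α : ℝ) (δ b : EReal) : Prop :=
  nestedExponent cost c K ρ γ ≤ b ∧
    ∀ p : ℝ, b < (p : EReal) → MultilevelAchieves cost c K ρ γ L a α δ p

end Multilevel

end

/-! The squared worst case error on ℋ_γ is the sum of γ_u e((Q)_u; H_u)² over all u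
(`worstCaseError_sq`). Since K(c,c) = 0, functions in H_u vanish wherever a coordinate in u equals
c. On H_u the multilevel algorithm therefore reduces to the one quadrature on whose level max u
appears first, or to the zero algorithm if max u lies beyond v_m; on H_∅ it is exact. Grouping the
sets u by ℓ = max u makes (∗) applicable (`worstCaseError_multilevelRule_sq_le`).

For POD weights, the bracket in (∗) and the truncation term ∑ γ_u C₀^{|u|} over max u = ℓ are both
at most a constant times γ_ℓ: elementary symmetric sums gain 1/k!, which beats (k!)^{q/r} when q < r
< δ (`exists_rpow_sum_max_podWeights_le`). Since γ_ℓ = O(ℓ^{-β}) for all β < δ, the tail beyond L_k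
is O(a^{-κk}) for any κ < δ - 1, and e² is bounded by a multiple of ∑_k a^{-κ(k-1)} n_k^{-2τ} +
a^{-κm}.

Take n_k ≈ a^{λ(m-k)} with κ/(2τ) < λ < s. Then the finest levels dominate both error and cost: e²
is of order a^{-κm} and the cost of order a^{sm}, which gives the exponent 2s/κ
(`multilevelAchieves_of_tail_le`). The other regimes need no separate choice of n_k, because the
cost exponent may be enlarged and κ decreased. With κ = d - 1 < δ - 1 and s' = κp/2 ≥ s the exponent
is exactly p, and the condition κ < 2τs' reads τ > 1/p. Such an admissible τ exists when p > 1/α and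
p > 2/δ, because the decay of all the weights equals that of the singletons
(`decay_top_podWeights`). So every p > max{1/α, 2/δ, 2s/(δ-1)} is achieved, and in each case of the
theorem this maximum is b. -/

namespace ScalarKernel

/-! ### Point evaluation and integration in a reproducing kernel Hilbert space. -/

variable {X : Type} (k : ScalarKernel X)

/-- The kernel function `k(·, x)` as an element of the reproducing kernel Hilbert space. -/
noncomputable def feature (x : X) : k.Space := RKHS.kerFun k.Space x 1

theorem inner_feature (x : X) (f : k.Space) : inner ℝ (k.feature x) f = f x := by
  simp [feature, RKHS.kerFun_inner]

theorem feature_apply (x y : X) : k.feature x y = k y x := by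
  rw [feature, RKHS.kerFun_apply k.Space x 1 y, RKHS.OfKernel.kernel_ofKernel]
  simp [opMatrix]

theorem norm_feature_sq (x : X) : ‖k.feature x‖ ^ 2 = k x x := by
  rw [← real_inner_self_eq_norm_sq, inner_feature, feature_apply]

theorem abs_apply_le (f : k.Space) (x : X) : |f x| ≤ ‖f‖ * √(k x x) := by
  rw [← inner_feature, ← norm_feature_sq, Real.sqrt_sq (norm_nonneg _), mul_comm]
  exact abs_real_inner_le_norm _ _

theorem apply_eq_zero_of_diag_eq_zero (f : k.Space) {x : X} (hx : k x x = 0) : f x = 0 := by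
  have := k.abs_apply_le f x
  rw [hx] at this
  simpa using this

theorem apply_congr (f : k.Space) {x y : X} (h : ∀ z, k z x = k z y) : f x = f y := by
  have : k.feature x = k.feature y := by
    ext z
    rw [feature_apply, feature_apply, h]
  rw [← inner_feature, this, inner_feature]

/-- The kernel sections span a dense subspace, and norm convergence implies pointwise convergence,
so f is a pointwise limit of a sequence of measurable functions. -/
theorem measurable_apply [MeasurableSpace X] (hk : ∀ y, Measurable fun x => k x y)
    (f : k.Space) : Measurable f := by
  have hspan : ∀ g ∈ Submodule.span ℝ {RKHS.kerFun k.Space x v | (x) (v)}, Measurable g := by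
    intro g hg
    induction hg using Submodule.span_induction with
    | mem g hg =>
      obtain ⟨x, v, rfl⟩ := hg
      have : ⇑(RKHS.kerFun k.Space x v) = fun y => v * k y x := by
        funext y
        rw [RKHS.kerFun_apply k.Space x v y, RKHS.OfKernel.kernel_ofKernel]
        simp [opMatrix, mul_comm]
      rw [this]
      exact (hk x).const_mul v
    | zero => rw [RKHS.coe_zero]; exact measurable_const
    | add g h _ _ hg hh => rw [RKHS.coe_add]; exact hg.add hh
    | smul a g _ hg => rw [RKHS.coe_smul]; exact hg.const_smul a
  have hf : f ∈ closure (Submodule.span ℝ {RKHS.kerFun k.Space x v | (x) (v)} : Set k.Space) := by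
    have : f ∈ (Submodule.span ℝ {RKHS.kerFun k.Space x v | (x) (v)}).topologicalClosure := by
      rw [RKHS.kerFun_dense]; trivial
    exact this
  obtain ⟨u, hu, hlim⟩ := mem_closure_iff_seq_limit.mp hf
  refine measurable_of_tendsto_metrizable (fun n => hspan _ (hu n)) ?_
  exact tendsto_pi_nhds.mpr fun x => ((RKHS.continuous_eval x).tendsto f).comp hlim

theorem integrable_apply [MeasurableSpace X] {μ : Measure X} [IsFiniteMeasure μ]
    (hk : ∀ y, Measurable fun x => k x y) (hint : Integrable (fun x => k x x) μ)
    (f : k.Space) : Integrable f μ := by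
  refine (((integrable_const 1).add hint).const_mul ‖f‖).mono'
    (k.measurable_apply hk f).aestronglyMeasurable (.of_forall fun x => ?_)
  refine (k.abs_apply_le f x).trans (mul_le_mul_of_nonneg_left ?_ (norm_nonneg _))
  have := k.diag_nonneg x
  rw [Pi.add_apply, Real.sqrt_le_left (by linarith)]
  nlinarith

/-- Integration is represented by an element of the reproducing kernel Hilbert space. -/
theorem exists_inner_eq_integral [MeasurableSpace X] {μ : Measure X} [IsFiniteMeasure μ]
    (hk : ∀ y, Measurable fun x => k x y) (hint : Integrable (fun x => k x x) μ) :
    ∃ h : k.Space, ∀ f : k.Space, inner ℝ h f = ∫ x, f x ∂μ := by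
  have hi := k.integrable_apply hk hint
  let T : k.Space →ₗ[ℝ] ℝ :=
    { toFun := fun f => ∫ x, f x ∂μ
      map_add' := fun f g => by
        rw [RKHS.coe_add]
        exact integral_add (hi f) (hi g)
      map_smul' := fun a f => by
        rw [RKHS.coe_smul]
        exact integral_const_mul a _ }
  have hT : ∀ f, ‖T f‖ ≤ (∫ x, (1 + k x x) ∂μ) * ‖f‖ := by
    intro f
    rw [mul_comm, ← integral_const_mul]
    refine (norm_integral_le_integral_norm _).trans ?_
    refine integral_mono (hi f).norm (((integrable_const 1).add hint).const_mul ‖f‖) fun x => ?_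
    refine (k.abs_apply_le f x).trans (mul_le_mul_of_nonneg_left ?_ (norm_nonneg _))
    have := k.diag_nonneg x
    rw [Real.sqrt_le_left (by linarith)]
    nlinarith
  refine ⟨(InnerProductSpace.toDual ℝ k.Space).symm (T.mkContinuous _ hT), fun f => ?_⟩
  rw [InnerProductSpace.toDual_symm_apply]
  rfl

end ScalarKernel

/-- Turns worst case errors into norms of representers of the error functional; the supremum is
attained at R/‖R‖. -/
theorem iSup_ofReal_abs_inner {H : Type*} [NormedAddCommGroup H] [InnerProductSpace ℝ H] (R : H) :
    ⨆ (f : H) (_ : ‖f‖ ≤ 1), ENNReal.ofReal |inner ℝ R f| = ENNReal.ofReal ‖R‖ := by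
  refine le_antisymm (iSup₂_le fun f hf => ENNReal.ofReal_le_ofReal ?_) ?_
  · exact (abs_real_inner_le_norm R f).trans (mul_le_of_le_one_right (norm_nonneg _) hf)
  · rcases eq_or_ne R 0 with rfl | hR
    · simp
    · have hR' : ‖R‖ ≠ 0 := norm_ne_zero_iff.mpr hR
      refine le_iSup₂_of_le (‖R‖⁻¹ • R) ?_ (ENNReal.ofReal_le_ofReal ?_)
      · rw [norm_smul, norm_inv, norm_norm, inv_mul_cancel₀ hR']
      · rw [real_inner_smul_right, real_inner_self_eq_norm_sq, sq, ← mul_assoc,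
          inv_mul_cancel₀ hR', one_mul]
        exact le_abs_self _

/-! ### Sampling rules as linear functionals. -/

namespace SamplingRule

variable {E : Type}

@[simp] theorem eval_nil (f : (ℕ → E) → ℝ) : eval [] f = 0 := by simp [eval]

@[simp] theorem eval_cons (p : ℝ × (ℕ → E)) (Q : SamplingRule E) (f : (ℕ → E) → ℝ) :
    eval (p :: Q) f = p.1 * f p.2 + eval Q f := by simp [eval]

theorem eval_congr {Q : SamplingRule E} {f f' : (ℕ → E) → ℝ} (h : ∀ p ∈ Q, f p.2 = f' p.2) :
    Q.eval f = Q.eval f' := by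
  induction Q with
  | nil => simp
  | cons p Q ih =>
    rw [eval_cons, eval_cons, h p (by simp), ih fun q hq => h q (List.mem_cons_of_mem _ hq)]

theorem eval_eq_zero {Q : SamplingRule E} {f : (ℕ → E) → ℝ} (h : ∀ p ∈ Q, f p.2 = 0) :
    Q.eval f = 0 := by
  induction Q with
  | nil => simp
  | cons p Q ih =>
    rw [eval_cons, h p (by simp), ih fun q hq => h q (List.mem_cons_of_mem _ hq)]
    simp

theorem abs_eval_le (Q : SamplingRule E) {f b : (ℕ → E) → ℝ} (h : ∀ x, |f x| ≤ b x) :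
    |Q.eval f| ≤ (Q.map fun p => |p.1| * b p.2).sum := by
  induction Q with
  | nil => simp
  | cons p Q ih =>
    rw [eval_cons, List.map_cons, List.sum_cons]
    refine (abs_add_le _ _).trans (add_le_add ?_ ih)
    rw [abs_mul]
    exact mul_le_mul_of_nonneg_left (h _) (abs_nonneg _)

theorem hasSum_eval {ι : Type*} (Q : SamplingRule E) {F : ι → (ℕ → E) → ℝ} {f : (ℕ → E) → ℝ}
    (h : ∀ p ∈ Q, HasSum (fun i => F i p.2) (f p.2)) :
    HasSum (fun i => Q.eval (F i)) (Q.eval f) := by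
  induction Q with
  | nil => simp
  | cons p Q ih =>
    simp only [eval_cons]
    exact ((h p (by simp)).mul_left p.1).add (ih fun q hq => h q (List.mem_cons_of_mem _ hq))

theorem eval_const_mul (Q : SamplingRule E) (a : ℝ) (f : (ℕ → E) → ℝ) :
    Q.eval (fun x => a * f x) = a * Q.eval f := by
  induction Q with
  | nil => simp
  | cons p Q ih => simp only [eval_cons, ih]; ring

/-- If point evaluations and integration are represented by inner products, then so is the error
functional. -/
theorem exists_inner_eq_error [MeasurableSpace E] {ρ : Measure E} {H : Type*}
    [NormedAddCommGroup H] [InnerProductSpace ℝ H] (φ : H → (ℕ → E) → ℝ)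
    (hI : ∃ h : H, ∀ f, inner ℝ h f = integralFunctional ρ (φ f))
    (hx : ∀ x, ∃ r : H, ∀ f, inner ℝ r f = φ f x) (Q : SamplingRule E) :
    ∃ R : H, ∀ f, inner ℝ R f = integralFunctional ρ (φ f) - Q.eval (φ f) := by
  induction Q with
  | nil => simpa using hI
  | cons p Q ih =>
    obtain ⟨R, hR⟩ := ih
    obtain ⟨r, hr⟩ := hx p.2
    refine ⟨R - p.1 • r, fun f => ?_⟩
    rw [inner_sub_left, real_inner_smul_left, hR, hr, eval_cons]
    ring

end SamplingRule

/-! ### Integrals of finite products under the infinite product measure. -/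

section ProductIntegral

variable {E : Type} [MeasurableSpace E] (ρ : Measure E) [IsProbabilityMeasure ρ]

theorem integrable_prod_infinitePi {u : Finset ℕ} {f : ℕ → E → ℝ}
    (hf : ∀ j ∈ u, Integrable (f j) ρ) :
    Integrable (fun x : ℕ → E => ∏ j ∈ u, f j (x j)) (Measure.infinitePi fun _ : ℕ => ρ) := by
  have h1 : Integrable (fun x : u → E => ∏ j : u, f j (x j)) (Measure.pi fun _ : u => ρ) :=
    Integrable.fintype_prod fun j => hf j j.2
  have h2 : MeasurePreserving (u.restrict) (Measure.infinitePi fun _ : ℕ => ρ)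
      (Measure.pi fun _ : u => ρ) :=
    ⟨Finset.measurable_restrict u, Measure.infinitePi_map_restrict _⟩
  have h3 := (h2.integrable_comp h1.aestronglyMeasurable).mpr h1
  refine h3.congr (.of_forall fun x => ?_)
  exact Finset.prod_coe_sort u fun j => f j (x j)

theorem integral_prod_infinitePi {u : Finset ℕ} {f : ℕ → E → ℝ}
    (hf : ∀ j ∈ u, Integrable (f j) ρ) :
    ∫ x, ∏ j ∈ u, f j (x j) ∂(Measure.infinitePi fun _ : ℕ => ρ) = ∏ j ∈ u, ∫ x, f j x ∂ρ := by
  have h1 : Integrable (fun x : u → E => ∏ j : u, f j (x j)) (Measure.pi fun _ : u => ρ) :=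
    Integrable.fintype_prod fun j => hf j j.2
  have h2 := integral_restrict_infinitePi (fun _ : ℕ => ρ) h1.aestronglyMeasurable
  rw [integral_fintype_prod_eq_prod (μ := fun _ : u => ρ) (fun j : u => f j)] at h2
  rw [← Finset.prod_coe_sort u fun j => ∫ x, f j x ∂ρ, ← h2]
  refine integral_congr_ae (.of_forall fun x => ?_)
  exact (Finset.prod_coe_sort u fun j => f j (x j)).symm

end ProductIntegral

/-! ### Decomposition of the worst case error over the component spaces. -/

section ErrorDecomposition

variable {E : Type} [MeasurableSpace E] {K : ScalarKernel E} {ρ : Measure E}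

theorem measurable_kernel_diag (hK : Measurable (Function.uncurry K.toFun)) :
    Measurable fun x => K x x :=
  hK.comp (measurable_id.prodMk measurable_id)

theorem measurable_kernel_left (hK : Measurable (Function.uncurry K.toFun)) (y : E) :
    Measurable fun x => K x y :=
  hK.comp (measurable_id.prodMk measurable_const)

theorem measurable_prodKernel_left (hK : Measurable (Function.uncurry K.toFun)) (u : Finset ℕ)
    (y : ℕ → E) : Measurable fun x => prodKernel K u x y :=
  Finset.measurable_fun_prod u fun j _ =>
    (measurable_kernel_left hK (y j)).comp (measurable_pi_apply j)

theorem measurable_prodKernel_diag (hK : Measurable (Function.uncurry K.toFun)) (u : Finset ℕ) :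
    Measurable fun x => prodKernel K u x x :=
  Finset.measurable_fun_prod u fun j _ =>
    (measurable_kernel_diag hK).comp (measurable_pi_apply j)

theorem measurableSet_weightedDomain (hK : Measurable (Function.uncurry K.toFun))
    (γ : Finset ℕ → ℝ≥0) : MeasurableSet (weightedDomain K γ) := by
  have : weightedDomain K γ =
      {x | ∑' u : Finset ℕ, ENNReal.ofReal ((γ u : ℝ) * prodKernel K u x x) ≠ ⊤} := by
    ext x
    refine ⟨fun h => ENNReal.tsum_coe_ne_top_iff_summable.mpr h.toNNReal, fun h => ?_⟩
    refine (NNReal.summable_coe.mpr (ENNReal.tsum_coe_ne_top_iff_summable.mp h)).congr fun u => ?_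
    exact Real.coe_toNNReal _ (mul_nonneg (γ u).coe_nonneg ((prodKernel K u).diag_nonneg x))
  rw [this]
  refine (measurableSet_eq_fun (Measurable.tsum fun u => ?_) measurable_const).compl
  exact ((measurable_prodKernel_diag hK u).const_mul _).ennreal_ofReal

theorem integralFunctional_extend (hK : Measurable (Function.uncurry K.toFun))
    (γ : Finset ℕ → ℝ≥0) (f : weightedDomain K γ → ℝ) :
    integralFunctional ρ (Function.extend Subtype.val f 0)
      = ∫ x, f x ∂((Measure.infinitePi fun _ : ℕ => ρ).comap Subtype.val) := by
  have h1 : ∀ x : weightedDomain K γ, f x = Function.extend Subtype.val f 0 x.1 := fun x =>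
    (Subtype.val_injective.extend_apply f 0 x).symm
  simp_rw [h1]
  rw [integral_subtype_comap (measurableSet_weightedDomain hK γ)
    (Function.extend Subtype.val f 0)]
  refine (setIntegral_eq_integral_of_forall_compl_eq_zero fun x hx => ?_).symm
  rw [Function.extend_apply' _ _ _ (by simpa using hx)]
  rfl

variable [IsProbabilityMeasure ρ]

theorem integrable_kernel_left (hK : Measurable (Function.uncurry K.toFun))
    (hM : Integrable (fun x => K x x) ρ) (y : E) : Integrable (fun x => K x y) ρ := by
  refine (hM.add (integrable_const (K y y))).mono'
    (measurable_kernel_left hK y).aestronglyMeasurable (.of_forall fun x => ?_)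
  have := K.two_mul_abs_le_diag x y
  have := abs_nonneg (K x y)
  rw [Real.norm_eq_abs, Pi.add_apply]
  linarith

theorem integrable_prodKernel_diag (hM : Integrable (fun x => K x x) ρ) (u : Finset ℕ) :
    Integrable (fun x => prodKernel K u x x) (Measure.infinitePi fun _ : ℕ => ρ) :=
  integrable_prod_infinitePi ρ fun _ _ => hM

theorem integral_prodKernel_diag (hM : Integrable (fun x => K x x) ρ) (u : Finset ℕ) :
    ∫ x, prodKernel K u x x ∂(Measure.infinitePi fun _ : ℕ => ρ)
      = diagonalConstant K ρ ^ u.card := by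
  refine (integral_prod_infinitePi ρ fun _ _ => hM).trans ?_
  rw [Finset.prod_const]
  rfl

theorem integral_prodKernel_left (hK : Measurable (Function.uncurry K.toFun))
    (hM : Integrable (fun x => K x x) ρ) (u : Finset ℕ) (y : ℕ → E) :
    ∫ x, prodKernel K u x y ∂(Measure.infinitePi fun _ : ℕ => ρ)
      = ∏ j ∈ u, ∫ x, K x (y j) ∂ρ :=
  integral_prod_infinitePi ρ (f := fun j x => K x (y j)) fun j _ =>
    integrable_kernel_left hK hM (y j)

theorem integrable_integral_kernel (hK : Measurable (Function.uncurry K.toFun))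
    (hM : Integrable (fun x => K x x) ρ) : Integrable (fun y => ∫ x, K x y ∂ρ) ρ := by
  have hmeas : AEStronglyMeasurable (fun y => ∫ x, K x y ∂ρ) ρ := by
    have := (hK.comp measurable_swap).stronglyMeasurable.integral_prod_right' (ν := ρ)
    exact this.aestronglyMeasurable
  refine ((integrable_const (diagonalConstant K ρ)).add hM).mono' hmeas (.of_forall fun y => ?_)
  refine (norm_integral_le_integral_norm _).trans ?_
  have : ∫ x, (K x x + K y y) ∂ρ = diagonalConstant K ρ + K y y := by
    rw [integral_add hM (integrable_const _)]
    simp [diagonalConstant]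
  rw [Pi.add_apply, ← this]
  refine integral_mono (integrable_kernel_left hK hM y).norm (hM.add (integrable_const _))
    fun x => ?_
  have := K.two_mul_abs_le_diag x y
  have := abs_nonneg (K x y)
  simp only [Real.norm_eq_abs]
  linarith

/-- By Tonelli the integral equals ∑ γ_u M^{|u|}. It yields both that 𝔛 has full measure and that
the diagonal of the weighted kernel is integrable. -/
theorem lintegral_tsum_prodKernel_ne_top (hK : Measurable (Function.uncurry K.toFun))
    (hM : Integrable (fun x => K x x) ρ) {γ : Finset ℕ → ℝ≥0}
    (hsum : Summable fun u : Finset ℕ => (γ u : ℝ) * diagonalConstant K ρ ^ u.card) :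
    ∫⁻ x, ∑' u : Finset ℕ, ENNReal.ofReal ((γ u : ℝ) * prodKernel K u x x)
      ∂(Measure.infinitePi fun _ : ℕ => ρ) ≠ ⊤ := by
  rw [lintegral_tsum fun u =>
    ((measurable_prodKernel_diag hK u).const_mul _).ennreal_ofReal.aemeasurable]
  have : ∀ u : Finset ℕ, ∫⁻ x, ENNReal.ofReal ((γ u : ℝ) * prodKernel K u x x)
      ∂(Measure.infinitePi fun _ : ℕ => ρ)
      = ENNReal.ofReal ((γ u : ℝ) * diagonalConstant K ρ ^ u.card) := fun u => by
    rw [← ofReal_integral_eq_lintegral_ofReal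
      ((integrable_prodKernel_diag hM u).const_mul _)
      (.of_forall fun x => mul_nonneg (γ u).coe_nonneg ((prodKernel K u).diag_nonneg x)),
      integral_const_mul, integral_prodKernel_diag hM]
  rw [tsum_congr this]
  exact ENNReal.tsum_coe_ne_top_iff_summable.mpr hsum.toNNReal

theorem ae_mem_weightedDomain (hK : Measurable (Function.uncurry K.toFun))
    (hM : Integrable (fun x => K x x) ρ) {γ : Finset ℕ → ℝ≥0}
    (hsum : Summable fun u : Finset ℕ => (γ u : ℝ) * diagonalConstant K ρ ^ u.card) :
    ∀ᵐ x ∂(Measure.infinitePi fun _ : ℕ => ρ), x ∈ weightedDomain K γ := by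
  filter_upwards [ae_lt_top (Measurable.tsum fun u =>
    ((measurable_prodKernel_diag hK u).const_mul _).ennreal_ofReal)
    (lintegral_tsum_prodKernel_ne_top hK hM hsum)] with x hx
  refine (NNReal.summable_coe.mpr
    (ENNReal.tsum_coe_ne_top_iff_summable.mp hx.ne)).congr fun u => ?_
  exact Real.coe_toNNReal _ (mul_nonneg (γ u).coe_nonneg ((prodKernel K u).diag_nonneg x))

theorem exists_componentError_eq (hK : Measurable (Function.uncurry K.toFun))
    (hM : Integrable (fun x => K x x) ρ) (u : Finset ℕ) (Q : SamplingRule E) :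
    ∃ R : (prodKernel K u).Space,
      (∀ f : (prodKernel K u).Space, inner ℝ R f = integralFunctional ρ f - Q.eval f) ∧
      componentError K ρ u Q = ENNReal.ofReal ‖R‖ := by
  obtain ⟨R, hR⟩ := SamplingRule.exists_inner_eq_error (ρ := ρ)
    (fun f : (prodKernel K u).Space => ⇑f)
    ((prodKernel K u).exists_inner_eq_integral (measurable_prodKernel_left hK u)
      (integrable_prodKernel_diag hM u))
    (fun x => ⟨(prodKernel K u).feature x, fun f => (prodKernel K u).inner_feature x f⟩) Q
  refine ⟨R, hR, ?_⟩
  rw [← iSup_ofReal_abs_inner]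
  simp_rw [hR]
  rfl

/-- Interchanges the error functional with the series ∑ γ_u φ_u. The bound by A·K_u(x,x) + B_u gives
pointwise convergence on 𝔛 and, after integration, the summable majorant A γ_u M^{|u|} + γ_u B_u. It
is used twice below, for kernel sections and for representers. -/
theorem hasSum_integral_sub_eval (hK : Measurable (Function.uncurry K.toFun))
    (hM : Integrable (fun x => K x x) ρ) {γ : Finset ℕ → ℝ≥0}
    (hsum : Summable fun u : Finset ℕ => (γ u : ℝ) * diagonalConstant K ρ ^ u.card)
    {φ : Finset ℕ → (ℕ → E) → ℝ} (hφ : ∀ u, Measurable (φ u)) {A : ℝ} {B : Finset ℕ → ℝ}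
    (hB : Summable fun u => (γ u : ℝ) * B u)
    (hbound : ∀ u x, |φ u x| ≤ A * prodKernel K u x x + B u)
    {Q : SamplingRule E} (hQ : ∀ p ∈ Q, p.2 ∈ weightedDomain K γ) {F : weightedDomain K γ → ℝ}
    (hF : ∀ x, F x = ∑' u, (γ u : ℝ) * φ u x) :
    HasSum (fun u => (γ u : ℝ) * (integralFunctional ρ (φ u) - Q.eval (φ u)))
      (integralFunctional ρ (Function.extend Subtype.val F 0)
        - Q.eval (Function.extend Subtype.val F 0)) := by
  have hext : ∀ x (hx : x ∈ weightedDomain K γ),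
      Function.extend Subtype.val F 0 x = ∑' u, (γ u : ℝ) * φ u x := fun x hx => by
    rw [← hF ⟨x, hx⟩]
    exact Subtype.val_injective.extend_apply F 0 ⟨x, hx⟩
  have hsumm : ∀ x ∈ weightedDomain K γ, Summable fun u => (γ u : ℝ) * φ u x := by
    intro x hx
    refine Summable.of_norm_bounded ((hx.mul_left A).add hB) fun u => ?_
    rw [norm_mul, Real.norm_eq_abs, Real.norm_eq_abs, NNReal.abs_eq]
    refine (mul_le_mul_of_nonneg_left (hbound u x) (γ u).coe_nonneg).trans_eq ?_
    change (γ u : ℝ) * (A * ∏ j ∈ u, K (x j) (x j) + B u) = _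
    ring
  have hdom : ∀ u, Integrable (fun x => A * prodKernel K u x x + B u)
      (Measure.infinitePi fun _ : ℕ => ρ) := fun u =>
    ((integrable_prodKernel_diag hM u).const_mul A).add (integrable_const _)
  have hint : ∀ u, Integrable (φ u) (Measure.infinitePi fun _ : ℕ => ρ) := fun u =>
    (hdom u).mono' (hφ u).aestronglyMeasurable (.of_forall (hbound u))
  have h1 := hasSum_integral_of_summable_integral_norm
    (μ := Measure.infinitePi fun _ : ℕ => ρ) (F := fun u x => (γ u : ℝ) * φ u x)
    (fun u => (hint u).const_mul _) (by
      refine Summable.of_nonneg_of_le (fun u => integral_nonneg fun x => norm_nonneg _)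
        (fun u => ?_) ((hsum.mul_left A).add hB)
      calc ∫ x, ‖(γ u : ℝ) * φ u x‖ ∂(Measure.infinitePi fun _ : ℕ => ρ)
          ≤ ∫ x, (γ u : ℝ) * (A * prodKernel K u x x + B u)
            ∂(Measure.infinitePi fun _ : ℕ => ρ) := by
            refine integral_mono ((hint u).const_mul _).norm ((hdom u).const_mul _) fun x => ?_
            simp only [norm_mul, Real.norm_eq_abs, NNReal.abs_eq]
            exact mul_le_mul_of_nonneg_left (hbound u x) (γ u).coe_nonneg
        _ = A * ((γ u : ℝ) * diagonalConstant K ρ ^ u.card) + (γ u : ℝ) * B u := by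
            rw [integral_const_mul, integral_add ((integrable_prodKernel_diag hM u).const_mul A)
              (integrable_const _), integral_const_mul, integral_prodKernel_diag hM]
            simp
            ring)
  have h2 : integralFunctional ρ (Function.extend Subtype.val F 0)
      = ∫ x, ∑' u, (γ u : ℝ) * φ u x ∂(Measure.infinitePi fun _ : ℕ => ρ) := by
    refine integral_congr_ae ?_
    filter_upwards [ae_mem_weightedDomain hK hM hsum] with x hx
    exact hext x hx
  have h3 : HasSum (fun u => Q.eval fun x => (γ u : ℝ) * φ u x)
      (Q.eval (Function.extend Subtype.val F 0)) :=
    Q.hasSum_eval fun p hp => by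
      rw [hext p.2 (hQ p hp)]
      exact (hsumm p.2 (hQ p hp)).hasSum
  rw [h2]
  refine (h1.sub h3).congr_fun fun u => ?_
  rw [SamplingRule.eval_const_mul, integral_const_mul, mul_sub]
  rfl

/-- The squared worst case error in the weighted space is the weighted sum of the squared worst
case errors in the component spaces. -/
theorem worstCaseError_sq (hK : Measurable (Function.uncurry K.toFun))
    (hM : Integrable (fun x => K x x) ρ) {γ : Finset ℕ → ℝ≥0}
    (hsum : Summable fun u : Finset ℕ => (γ u : ℝ) * diagonalConstant K ρ ^ u.card)
    {Q : SamplingRule E} (hQ : ∀ p ∈ Q, p.2 ∈ weightedDomain K γ) :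
    worstCaseError K ρ γ Q ^ 2 = ∑' u, (γ u : ℝ≥0∞) * componentError K ρ u Q ^ 2 := by
  choose r hr hre using fun u => exists_componentError_eq hK hM u Q
  set κ := weightedKernel K γ with hκ
  have hκm : ∀ y, Measurable fun x => κ x y := by
    intro y
    have hs : ∀ x : weightedDomain K γ, Tendsto
        (fun s : Finset (Finset ℕ) => ∑ u ∈ s, (γ u : ℝ) * prodKernel K u x y) atTop
        (𝓝 (κ x y)) := fun x => (summable_weightedKernel K γ x y).hasSum
    refine measurable_of_tendsto_metrizable' atTop (fun s => ?_) (tendsto_pi_nhds.mpr hs)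
    exact Finset.measurable_fun_sum s fun u _ =>
      ((measurable_prodKernel_left hK u y.1).comp measurable_subtype_coe).const_mul _
  -- The space lives on the subtype 𝔛, so the representer of integration is built for the
  -- restriction of μ to 𝔛.
  have hκd : Integrable (fun x => κ x x)
      ((Measure.infinitePi fun _ : ℕ => ρ).comap (Subtype.val : weightedDomain K γ → ℕ → E)) := by
    have hm : Measurable fun x => κ x x := by
      have hs : ∀ x : weightedDomain K γ, Tendsto
          (fun s : Finset (Finset ℕ) => ∑ u ∈ s, (γ u : ℝ) * prodKernel K u x x) atTop
          (𝓝 (κ x x)) := fun x => (summable_weightedKernel K γ x x).hasSum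
      refine measurable_of_tendsto_metrizable' atTop (fun s => ?_) (tendsto_pi_nhds.mpr hs)
      exact Finset.measurable_fun_sum s fun u _ =>
        ((measurable_prodKernel_diag hK u).comp measurable_subtype_coe).const_mul _
    refine ⟨hm.aestronglyMeasurable, ?_⟩
    have he : ∀ x : weightedDomain K γ, ‖κ x x‖ₑ
        = ∑' u : Finset ℕ, ENNReal.ofReal ((γ u : ℝ) * prodKernel K u x x) := fun x => by
      rw [Real.enorm_of_nonneg (κ.diag_nonneg x)]
      exact ENNReal.ofReal_tsum_of_nonneg
        (fun u => mul_nonneg (γ u).coe_nonneg ((prodKernel K u).diag_nonneg x))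
        (summable_weightedKernel K γ x x)
    rw [HasFiniteIntegral, lintegral_congr he, lintegral_subtype_comap
      (measurableSet_weightedDomain hK γ)
      fun x => ∑' u : Finset ℕ, ENNReal.ofReal ((γ u : ℝ) * prodKernel K u x x)]
    exact (setLIntegral_le_lintegral _ _).trans_lt
      (lintegral_tsum_prodKernel_ne_top hK hM hsum).lt_top
  obtain ⟨R, hR⟩ := SamplingRule.exists_inner_eq_error (ρ := ρ)
    (fun f : κ.Space => Function.extend Subtype.val f 0)
    (by
      obtain ⟨h, hh⟩ := κ.exists_inner_eq_integral hκm hκd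
      exact ⟨h, fun f => (hh f).trans (integralFunctional_extend hK γ f).symm⟩)
    (fun x => by
      by_cases hx : x ∈ weightedDomain K γ
      · refine ⟨κ.feature ⟨x, hx⟩, fun f => ?_⟩
        rw [κ.inner_feature]
        exact (Subtype.val_injective.extend_apply f 0 ⟨x, hx⟩).symm
      · refine ⟨0, fun f => ?_⟩
        rw [inner_zero_left, Function.extend_apply' _ _ _ (by simpa using hx)]
        rfl) Q
  have hw : worstCaseError K ρ γ Q = ENNReal.ofReal ‖R‖ := by
    rw [← iSup_ofReal_abs_inner]
    simp_rw [hR]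
    rfl
  have hru : ∀ u x, r u x = integralFunctional ρ (fun y => prodKernel K u y x)
      - Q.eval (fun y => prodKernel K u y x) := by
    intro u x
    rw [← (prodKernel K u).inner_feature, real_inner_comm, hr]
    have : ⇑((prodKernel K u).feature x) = fun y => prodKernel K u y x :=
      funext fun y => (prodKernel K u).feature_apply x y
    rw [this]
  have habs : ∀ u x y, |prodKernel K u y x|
      ≤ 1 * prodKernel K u y y + prodKernel K u x x := fun u x y => by
    have h1 := (prodKernel K u).two_mul_abs_le_diag y x
    have h2 := abs_nonneg (prodKernel K u y x)
    linarith
  -- First interchange: R(x) is the error functional applied to the section of ∑ γ_u K_u at x, and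
  -- its action on the section of K_u is r_u(x).
  have hRx : ∀ x : weightedDomain K γ, R x = ∑' u, (γ u : ℝ) * r u x := by
    intro x
    rw [← κ.inner_feature, real_inner_comm, hR]
    simp_rw [hru]
    exact (hasSum_integral_sub_eval hK hM hsum (φ := fun u y => prodKernel K u y x)
      (fun u => measurable_prodKernel_left hK u x) x.2 (fun u y => habs u x y) hQ
      (fun y => κ.feature_apply x y)).tsum_eq.symm
  -- This is the majorant required for the second interchange; its constant part is summable against
  -- γ because the sample points lie in 𝔛.
  have hbound : ∀ u x, |r u x| ≤ (1 + (Q.map fun p => |p.1|).sum) * prodKernel K u x x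
      + (diagonalConstant K ρ ^ u.card
        + (Q.map fun p => |p.1| * prodKernel K u p.2 p.2).sum) := by
    intro u x
    have h1 : |integralFunctional ρ fun y => prodKernel K u y x|
        ≤ diagonalConstant K ρ ^ u.card + prodKernel K u x x := by
      refine (norm_integral_le_integral_norm fun y => prodKernel K u y x).trans ?_
      calc _ ≤ ∫ y, (1 * prodKernel K u y y + prodKernel K u x x)
            ∂(Measure.infinitePi fun _ : ℕ => ρ) := by
            refine integral_mono_of_nonneg (.of_forall fun y => norm_nonneg _)
              (((integrable_prodKernel_diag hM u).const_mul 1).add (integrable_const _))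
              (.of_forall fun y => habs u x y)
        _ = _ := by
            rw [integral_add ((integrable_prodKernel_diag hM u).const_mul 1)
              (integrable_const _), integral_const_mul, integral_prodKernel_diag hM]
            simp
    have h2 := Q.abs_eval_le (fun y => habs u x y)
    have h3 : (Q.map fun p => |p.1| * (1 * prodKernel K u p.2 p.2 + prodKernel K u x x)).sum
        = (Q.map fun p => |p.1| * prodKernel K u p.2 p.2).sum
          + (Q.map fun p => |p.1|).sum * prodKernel K u x x := by
      rw [← List.sum_map_mul_right, ← List.sum_map_add]
      congr 1
      refine List.map_congr_left fun p _ => ?_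
      ring
    rw [hru]
    refine (abs_sub _ _).trans ((add_le_add h1 (h2.trans_eq h3)).trans_eq ?_)
    ring
  have hBsum : ∀ Q' : SamplingRule E, (∀ p ∈ Q', p.2 ∈ weightedDomain K γ) →
      Summable fun u => (γ u : ℝ) * (Q'.map fun p => |p.1| * prodKernel K u p.2 p.2).sum := by
    intro Q' hQ'
    induction Q' with
    | nil => simp
    | cons p Q' ih =>
      have hp : Summable fun u => (γ u : ℝ) * prodKernel K u p.2 p.2 := hQ' p (by simp)
      refine ((hp.mul_left |p.1|).add (ih fun q hq => hQ' q (List.mem_cons_of_mem _ hq))).congr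
        fun u => ?_
      rw [List.map_cons, List.sum_cons]
      ring
  -- Second interchange: the error functional applied to its own representer R = ∑ γ_u r_u gives
  -- ‖R‖² = ∑ γ_u ‖r_u‖². No orthogonal decomposition of ℋ_γ is needed.
  have hfinal := hasSum_integral_sub_eval hK hM hsum (φ := fun u => ⇑(r u))
    (fun u => (prodKernel K u).measurable_apply (measurable_prodKernel_left hK u) (r u))
    ((hsum.add (hBsum Q hQ)).congr fun u => (mul_add _ _ _).symm) hbound hQ hRx
  rw [← hR, real_inner_self_eq_norm_sq] at hfinal
  simp_rw [← hr, real_inner_self_eq_norm_sq] at hfinal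
  rw [hw, ← ENNReal.ofReal_pow (norm_nonneg _), ← hfinal.tsum_eq,
    ENNReal.ofReal_tsum_of_nonneg (fun u => by positivity) hfinal.summable]
  refine tsum_congr fun u => ?_
  rw [hre, ← ENNReal.ofReal_pow (norm_nonneg _), ENNReal.ofReal_mul (γ u).coe_nonneg]
  simp

end ErrorDecomposition

/-! ### Multilevel algorithms on the component spaces. -/

section MultilevelError

variable {E : Type}

theorem monotone_levelDim (L : ℕ) {a : ℝ} (ha : 1 < a) : Monotone (levelDim L a) := by
  refine monotone_nat_of_le_succ fun k => ?_
  cases k with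
  | zero => exact Nat.zero_le _
  | succ k =>
    exact Nat.mul_le_mul_left L (Nat.ceil_mono (pow_le_pow_right₀ ha.le (Nat.le_succ k)))

theorem monotone_levelSet (L : ℕ) {a : ℝ} (ha : 1 < a) : Monotone (levelSet L a) :=
  fun _ _ h => Finset.range_subset_range.mpr (monotone_levelDim L ha h)

theorem anchorOutside_of_notMem {c : E} {v : Finset ℕ} {x : ℕ → E} {j : ℕ} (hj : j ∉ v) :
    anchorOutside c v x j = c := by simp [anchorOutside, hj]

theorem anchorOutside_of_mem {c : E} {v : Finset ℕ} {x : ℕ → E} {j : ℕ} (hj : j ∈ v) :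
    anchorOutside c v x j = x j := by simp [anchorOutside, hj]

variable {K : ScalarKernel E} {c : E}

/-- The diagonal value K_u(x,x) contains the factor K(c,c) = 0, and |f(x)|² ≤ ‖f‖² K_u(x,x). -/
theorem prodKernel_space_apply_eq_zero (hc : K c c = 0) {u : Finset ℕ}
    (f : (prodKernel K u).Space) {x : ℕ → E} {j : ℕ} (hj : j ∈ u) (hx : x j = c) : f x = 0 :=
  (prodKernel K u).apply_eq_zero_of_diag_eq_zero f
    (Finset.prod_eq_zero hj (by rw [hx, hc]))

theorem prodKernel_space_apply_congr {u : Finset ℕ} (f : (prodKernel K u).Space) {x y : ℕ → E}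
    (h : ∀ j ∈ u, x j = y j) : f x = f y :=
  (prodKernel K u).apply_congr f fun z => Finset.prod_congr rfl fun j hj => by rw [h j hj]

theorem multilevelRule_eval_empty {L : ℕ} {a : ℝ} {Q : ℕ → SamplingRule E} {m : ℕ}
    (f : (prodKernel K ∅).Space) :
    (multilevelRule c L a Q m).eval f = f fun _ => c := by
  rw [multilevelRule_eval, Finset.sum_eq_zero fun k _ => ?_, add_zero]
  refine SamplingRule.eval_eq_zero fun p _ => ?_
  rw [prodKernel_space_apply_congr f (y := anchorOutside c (levelSet L a k) p.2) (by simp),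
    sub_self]

/-- On the component with largest coordinate `ℓ`, only the level containing `ℓ` contributes. -/
theorem multilevelRule_eval_of_mem_level (hc : K c c = 0) {L : ℕ} {a : ℝ} (ha : 1 < a)
    {Q : ℕ → SamplingRule E} {m : ℕ}
    (hQ : ∀ k < m, ∀ p ∈ Q (k + 1), ∀ j ∉ levelSet L a (k + 1), p.2 j = c)
    {u : Finset ℕ} {ℓ : ℕ} (hℓ : ℓ ∈ u) (hu : u ⊆ Finset.range (ℓ + 1))
    {k₀ : ℕ} (hk₀ : ℓ ∉ levelSet L a k₀) (hk₁ : k₀ < m → ℓ ∈ levelSet L a (k₀ + 1)) (hm : k₀ ≤ m)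
    (f : (prodKernel K u).Space) :
    (multilevelRule c L a Q m).eval f = if k₀ < m then (Q (k₀ + 1)).eval f else 0 := by
  rw [multilevelRule_eval, prodKernel_space_apply_eq_zero hc f hℓ rfl, zero_add]
  have hlow : ∀ k, ℓ ∉ levelSet L a k → (Q (k + 1)).eval (fun x =>
      f x - f (anchorOutside c (levelSet L a k) x)) = (Q (k + 1)).eval f := fun k hk =>
    SamplingRule.eval_congr fun p _ => by
      rw [prodKernel_space_apply_eq_zero hc f hℓ (anchorOutside_of_notMem hk), sub_zero]
  -- Below level k₀ the sample points have coordinate ℓ equal to c, so both terms of the difference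
  -- vanish. Above it, u is contained in v_k and the two terms cancel.
  have hzero : ∀ k ∈ Finset.range m, k ≠ k₀ → (Q (k + 1)).eval (fun x =>
      f x - f (anchorOutside c (levelSet L a k) x)) = 0 := by
    intro k hk hne
    rw [Finset.mem_range] at hk
    rcases lt_or_gt_of_ne hne with hlt | hgt
    · have hk' : ℓ ∉ levelSet L a (k + 1) := fun h => hk₀ (monotone_levelSet L ha hlt h)
      rw [hlow k fun h => hk' (monotone_levelSet L ha (Nat.le_succ k) h)]
      exact SamplingRule.eval_eq_zero fun p hp =>
        prodKernel_space_apply_eq_zero hc f hℓ (hQ k hk p hp ℓ hk')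
    · have hk' : ℓ ∈ levelSet L a k :=
        monotone_levelSet L ha hgt (hk₁ (hgt.trans hk))
      have huk : u ⊆ levelSet L a k := hu.trans
        (Finset.range_subset_range.mpr (Finset.mem_range.mp hk'))
      refine SamplingRule.eval_eq_zero fun p _ => ?_
      rw [prodKernel_space_apply_congr f (y := anchorOutside c (levelSet L a k) p.2)
        fun j hj => (anchorOutside_of_mem (huk hj)).symm, sub_self]
  split_ifs with h
  · rw [Finset.sum_eq_single_of_mem k₀ (Finset.mem_range.mpr h) hzero, hlow k₀ hk₀]
  · refine Finset.sum_eq_zero fun k hk => hzero k hk ?_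
    rintro rfl
    exact h (Finset.mem_range.mp hk)

theorem admissible_multilevelRule {L : ℕ} {a : ℝ} {m : ℕ} {Q : ℕ → SamplingRule E}
    (hQ : ∀ k < m, ∀ p ∈ Q (k + 1), ∀ j ∉ levelSet L a (k + 1), p.2 j = c) :
    (multilevelRule c L a Q m).Admissible c := by
  have key : ∀ p ∈ multilevelRule c L a Q m, ∃ v : Finset ℕ, ∀ j ∉ v, p.2 j = c := by
    intro p hp
    simp only [multilevelRule, List.mem_cons, List.mem_flatMap, List.mem_range, List.mem_append,
      List.mem_map] at hp
    rcases hp with rfl | ⟨k, hk, hp | ⟨p', -, rfl⟩⟩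
    · exact ⟨∅, fun j _ => rfl⟩
    · exact ⟨_, hQ k hk p hp⟩
    · exact ⟨levelSet L a k, fun j hj => anchorOutside_of_notMem hj⟩
  intro p hp
  obtain ⟨v, hv⟩ := key p hp
  exact v.finite_toSet.subset fun j hj => by
    by_contra hjv
    exact hj (hv j hjv)

theorem mem_weightedDomain_of_mem_multilevelRule (hc : K c c = 0) (γ : Finset ℕ → ℝ≥0)
    {L : ℕ} {a : ℝ} {m : ℕ} {Q : ℕ → SamplingRule E}
    (hQ : ∀ k < m, ∀ p ∈ Q (k + 1), ∀ j ∉ levelSet L a (k + 1), p.2 j = c) :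
    ∀ p ∈ multilevelRule c L a Q m, p.2 ∈ weightedDomain K γ := by
  intro p hp
  exact mem_weightedDomain_of_finite K γ hc (admissible_multilevelRule hQ p hp)

variable [MeasurableSpace E] {ρ : Measure E}

theorem componentError_congr {u : Finset ℕ} {Q Q' : SamplingRule E}
    (h : ∀ f : (prodKernel K u).Space, Q.eval f = Q'.eval f) :
    componentError K ρ u Q = componentError K ρ u Q' := by
  simp only [componentError, h]

variable [IsProbabilityMeasure ρ]

/-- H_∅ consists of constants: the term f(c) integrates them exactly and every level difference is
zero. -/
theorem componentError_empty_multilevelRule {L : ℕ} {a : ℝ} {Q : ℕ → SamplingRule E} {m : ℕ} :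
    componentError K ρ ∅ (multilevelRule c L a Q m) = 0 := by
  refine le_antisymm (iSup₂_le fun f _ => ?_) bot_le
  have hf : ⇑f = fun _ => f fun _ => c :=
    funext fun x => prodKernel_space_apply_congr f (by simp)
  rw [multilevelRule_eval_empty, integralFunctional, hf]
  simp

/-- The squared norm of the representer of integration is its own integral, and this representer is
the product over j ∈ u of the functions y ↦ ∫ K(x, y_j) ρ(dx). -/
theorem componentError_nil_sq (hK : Measurable (Function.uncurry K.toFun))
    (hM : Integrable (fun x => K x x) ρ) (u : Finset ℕ) :
    componentError K ρ u [] ^ 2 = ENNReal.ofReal (meanConstant K ρ ^ u.card) := by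
  obtain ⟨R, hR, he⟩ := exists_componentError_eq hK hM u []
  rw [he, ← ENNReal.ofReal_pow (norm_nonneg _), ← real_inner_self_eq_norm_sq, hR]
  have hRx : ⇑R = fun y => ∏ j ∈ u, ∫ x, K x (y j) ∂ρ := by
    funext y
    rw [← (prodKernel K u).inner_feature, real_inner_comm, hR,
      ← integral_prodKernel_left hK hM u y]
    have : ⇑((prodKernel K u).feature y) = fun x => prodKernel K u x y :=
      funext fun x => (prodKernel K u).feature_apply y x
    rw [this, SamplingRule.eval_nil, sub_zero]
    rfl
  have := integral_prod_infinitePi ρ (u := u) (f := fun _ y => ∫ x, K x y ∂ρ) fun j _ =>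
    integrable_integral_kernel hK hM
  rw [SamplingRule.eval_nil, sub_zero, hRx, integralFunctional, this, Finset.prod_const]
  rfl

end MultilevelError

/-- Sums over all finite sets of natural numbers, split according to the largest element. -/
theorem tsum_finset_nat_le (f : Finset ℕ → ℝ≥0∞) :
    ∑' u, f u ≤ f ∅ + ∑' ℓ : ℕ, ∑ u ∈ (Finset.range (ℓ + 1)).powerset with ℓ ∈ u, f u := by
  have key : ∀ N : ℕ, ∑ u ∈ (Finset.range N).powerset, f u
      = f ∅ + ∑ ℓ ∈ Finset.range N, ∑ u ∈ (Finset.range (ℓ + 1)).powerset with ℓ ∈ u, f u := by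
    intro N
    induction N with
    | zero => simp
    | succ N ih =>
      rw [Finset.sum_range_succ, ← add_assoc, ← ih,
        ← Finset.sum_filter_not_add_sum_filter _ (fun u => N ∈ u)]
      congr 1
      refine Finset.sum_congr ?_ fun _ _ => rfl
      ext u
      simp only [Finset.mem_filter, Finset.mem_powerset]
      refine ⟨fun h x hx => ?_, fun h => ⟨h.trans (Finset.range_subset_range.mpr (by omega)),
        fun hN => absurd (h hN) (by simp)⟩⟩
      have h1 := Finset.mem_range.mp (h.1 hx)
      have h2 : x ≠ N := fun hxN => h.2 (hxN ▸ hx)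
      exact Finset.mem_range.mpr (by omega)
  rw [ENNReal.tsum_eq_iSup_sum]
  refine iSup_le fun s => ?_
  obtain ⟨N, hN⟩ : ∃ N, s ⊆ (Finset.range N).powerset := by
    refine ⟨s.sup (fun u => u.sup id + 1), fun u hu => Finset.mem_powerset.mpr fun x hx => ?_⟩
    have h1 : x ≤ u.sup id := Finset.le_sup (f := id) hx
    have h2 : u.sup id + 1 ≤ s.sup (fun u => u.sup id + 1) :=
      Finset.le_sup (f := fun u : Finset ℕ => u.sup id + 1) hu
    exact Finset.mem_range.mpr (by omega)
  refine (Finset.sum_le_sum_of_subset hN).trans ?_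
  rw [key]
  gcongr
  exact ENNReal.sum_le_tsum _

theorem ENNReal.tsum_ite_le_eq (f : ℕ → ℝ≥0∞) (N : ℕ) :
    ∑' ℓ, (if N ≤ ℓ then f ℓ else 0) = ∑' i, f (i + N) := by
  rw [← Summable.sum_add_tsum_nat_add' (k := N) ENNReal.summable, Finset.sum_eq_zero, zero_add]
  · simp
  · intro i hi
    rw [if_neg (by simpa using hi)]

/-! ### The error bound for multilevel algorithms. -/

section MultilevelBound

variable {E : Type} [MeasurableSpace E] {K : ScalarKernel E} {c : E} {ρ : Measure E}
  [IsProbabilityMeasure ρ]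

/-- Error bound for multilevel algorithms, in terms of an arbitrary bound `b ℓ` for the sums
`(∑_{max u = ℓ} γ_u^{1/(2τ)} C^{|u|})^{2τ}` and `∑_{max u = ℓ} γ_u C₀^{|u|}`. -/
theorem worstCaseError_multilevelRule_sq_le (hK : Measurable (Function.uncurry K.toFun))
    (hM : Integrable (fun x => K x x) ρ) (hc : K c c = 0) {γ : Finset ℕ → ℝ≥0}
    (hsum : Summable fun u : Finset ℕ => (γ u : ℝ) * diagonalConstant K ρ ^ u.card)
    {L : ℕ} {a : ℝ} (ha : 1 < a) {τ C : ℝ} {m : ℕ} {n : ℕ → ℕ}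
    {b : ℕ → ℝ} (hb : Summable b)
    (hb₁ : ∀ ℓ, (∑ u ∈ (Finset.range (ℓ + 1)).powerset with ℓ ∈ u,
      (γ u : ℝ) ^ (1 / (2 * τ)) * C ^ u.card) ^ (2 * τ) ≤ b ℓ)
    (hb₂ : ∀ ℓ, ∑ u ∈ (Finset.range (ℓ + 1)).powerset with ℓ ∈ u,
      (γ u : ℝ) * meanConstant K ρ ^ u.card ≤ b ℓ)
    (hC₀ : 0 ≤ meanConstant K ρ)
    {Q : ℕ → SamplingRule E}
    (hQ : ∀ k ∈ Set.Icc 1 m, IsLevelQuadrature c K ρ γ L a τ C k (n k) (Q k)) :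
    worstCaseError K ρ γ (multilevelRule c L a Q m) ^ 2 ≤ ENNReal.ofReal
      (∑ k ∈ Finset.range m, (∑' i, b (i + levelDim L a k)) * (n (k + 1) : ℝ) ^ (-(2 * τ))
        + ∑' i, b (i + levelDim L a m)) := by
  have hpt : ∀ k < m, ∀ p ∈ Q (k + 1), ∀ j ∉ levelSet L a (k + 1), p.2 j = c := fun k hk =>
    (hQ (k + 1) ⟨by omega, by omega⟩).2.1
  have hb₀ : ∀ ℓ, 0 ≤ b ℓ := fun ℓ =>
    (Finset.sum_nonneg fun u _ => mul_nonneg (γ u).coe_nonneg (pow_nonneg hC₀ _)).trans (hb₂ ℓ)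
  set w : ℕ → ℝ := fun k => (n (k + 1) : ℝ) ^ (-(2 * τ)) with hw
  have hw₀ : ∀ k, 0 ≤ w k := fun k => Real.rpow_nonneg (Nat.cast_nonneg _) _
  set F : ℕ → ℝ≥0∞ := fun ℓ => ∑ u ∈ (Finset.range (ℓ + 1)).powerset with ℓ ∈ u,
    (γ u : ℝ≥0∞) * componentError K ρ u (multilevelRule c L a Q m) ^ 2 with hF
  -- Only one summand is needed for each ℓ. Admitting all k with L_k ≤ ℓ enlarges the blocks L_k ≤ ℓ
  -- < L_{k+1} to whole tails, which costs only a constant later.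
  have hFle : ∀ ℓ, F ℓ ≤ ∑ k ∈ Finset.range m,
      (if levelDim L a k ≤ ℓ then ENNReal.ofReal (b ℓ * w k) else 0)
      + (if levelDim L a m ≤ ℓ then ENNReal.ofReal (b ℓ) else 0) := by
    intro ℓ
    by_cases hℓ : ℓ ∈ levelSet L a m
    · obtain ⟨k, hkm, hk₀, hk₁⟩ : ∃ k < m, ℓ ∉ levelSet L a k ∧ ℓ ∈ levelSet L a (k + 1) := by
        have hex : ∃ k, ℓ ∈ levelSet L a k := ⟨m, hℓ⟩
        classical
        have h0 : Nat.find hex ≠ 0 := fun h => by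
          have := Nat.find_spec hex
          rw [h] at this
          simp [levelSet, levelDim] at this
        obtain ⟨k, hk⟩ := Nat.exists_eq_succ_of_ne_zero h0
        refine ⟨k, ?_, Nat.find_min hex (by omega), ?_⟩
        · have := Nat.find_min' hex hℓ
          omega
        · have := Nat.find_spec hex
          rwa [hk] at this
      have h1 : F ℓ = ∑ u ∈ (Finset.range (ℓ + 1)).powerset with ℓ ∈ u,
          (γ u : ℝ≥0∞) * componentError K ρ u (Q (k + 1)) ^ 2 := by
        refine Finset.sum_congr rfl fun u hu => ?_
        rw [Finset.mem_filter, Finset.mem_powerset] at hu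
        rw [componentError_congr fun f => (multilevelRule_eval_of_mem_level hc ha hpt hu.2 hu.1
          hk₀ (fun _ => hk₁) hkm.le f).trans (if_pos hkm)]
      have h2 := (hQ (k + 1) ⟨by omega, by omega⟩).2.2 ℓ
        (Finset.mem_sdiff.mpr ⟨hk₁, by simpa using hk₀⟩)
      rw [h1]
      refine h2.trans (le_add_right ?_)
      have h3 : levelDim L a k ≤ ℓ := by simpa [levelSet] using hk₀
      refine le_trans ?_ (Finset.single_le_sum (fun _ _ => bot_le) (Finset.mem_range.mpr hkm))
      rw [if_pos h3]
      exact ENNReal.ofReal_le_ofReal (mul_le_mul_of_nonneg_right (hb₁ ℓ) (hw₀ k))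
    · have h1 : F ℓ = ENNReal.ofReal (∑ u ∈ (Finset.range (ℓ + 1)).powerset with ℓ ∈ u,
          (γ u : ℝ) * meanConstant K ρ ^ u.card) := by
        rw [ENNReal.ofReal_sum_of_nonneg fun u _ =>
          mul_nonneg (γ u).coe_nonneg (pow_nonneg hC₀ _)]
        refine Finset.sum_congr rfl fun u hu => ?_
        rw [Finset.mem_filter, Finset.mem_powerset] at hu
        rw [componentError_congr (Q' := []) fun f => (multilevelRule_eval_of_mem_level hc ha hpt
          hu.2 hu.1 hℓ (fun h => absurd h (lt_irrefl _)) le_rfl f).trans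
          ((if_neg (lt_irrefl _)).trans (SamplingRule.eval_nil _).symm),
          componentError_nil_sq hK hM, ENNReal.ofReal_mul (γ u).coe_nonneg,
          ENNReal.ofReal_coe_nnreal]
      have h3 : levelDim L a m ≤ ℓ := by simpa [levelSet] using hℓ
      rw [h1, if_pos h3]
      exact le_add_left (ENNReal.ofReal_le_ofReal (hb₂ ℓ))
  have hbs : ∀ k, Summable fun i => b (i + levelDim L a k) := fun k =>
    (summable_nat_add_iff _).mpr hb
  rw [worstCaseError_sq hK hM hsum (mem_weightedDomain_of_mem_multilevelRule hc γ hpt)]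
  refine (tsum_finset_nat_le _).trans ?_
  rw [componentError_empty_multilevelRule, zero_pow two_ne_zero, mul_zero, zero_add]
  refine (ENNReal.tsum_le_tsum hFle).trans_eq ?_
  rw [ENNReal.tsum_add, Summable.tsum_finsetSum fun _ _ => ENNReal.summable,
    ENNReal.ofReal_add (Finset.sum_nonneg fun k _ => mul_nonneg (tsum_nonneg fun i => hb₀ _)
      (hw₀ k)) (tsum_nonneg fun i => hb₀ _),
    ENNReal.ofReal_sum_of_nonneg fun k _ => mul_nonneg (tsum_nonneg fun i => hb₀ _) (hw₀ k),
    ENNReal.tsum_ite_le_eq (fun ℓ => ENNReal.ofReal (b ℓ)),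
    ENNReal.ofReal_tsum_of_nonneg (fun i => hb₀ _) (hbs m)]
  congr 1
  refine Finset.sum_congr rfl fun k _ => ?_
  rw [ENNReal.tsum_ite_le_eq (fun ℓ => ENNReal.ofReal (b ℓ * w k)), ← tsum_mul_right,
    ENNReal.ofReal_tsum_of_nonneg (fun i => mul_nonneg (hb₀ _) (hw₀ k)) ((hbs k).mul_right _)]

end MultilevelBound

/-! ### Sums of POD weights over sets with a prescribed largest element. -/

section Weights

/-- In the multinomial expansion of (∑ x_j)^k every squarefree monomial occurs k! times. The
induction uses (S + x)^{k+1} ≥ S^{k+1} + (k+1) x S^k. -/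
theorem sum_powersetCard_prod_le {x : ℕ → ℝ} (hx : ∀ j, 0 ≤ x j) (s : Finset ℕ) (k : ℕ) :
    ∑ u ∈ s.powersetCard k, ∏ j ∈ u, x j ≤ (∑ j ∈ s, x j) ^ k / k.factorial := by
  induction s using Finset.induction_on generalizing k with
  | empty =>
    cases k with
    | zero => simp
    | succ k =>
      rw [Finset.powersetCard_eq_empty.mpr (by simp)]
      simp
  | insert a s ha ih =>
    cases k with
    | zero => simp
    | succ k =>
      rw [Finset.powersetCard_succ_insert ha, Finset.sum_union, Finset.sum_image,
        Finset.sum_insert ha]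
      · have h1 : ∑ u ∈ s.powersetCard k, ∏ j ∈ insert a u, x j
            = x a * ∑ u ∈ s.powersetCard k, ∏ j ∈ u, x j := by
          rw [Finset.mul_sum]
          refine Finset.sum_congr rfl fun u hu => Finset.prod_insert fun hau => ha ?_
          exact (Finset.mem_powersetCard.mp hu).1 hau
        rw [h1]
        set S := ∑ j ∈ s, x j
        have hS : 0 ≤ S := Finset.sum_nonneg fun j _ => hx j
        have h2 : S ^ (k + 1) + (k + 1) * (x a * S ^ k) ≤ (x a + S) ^ (k + 1) := by
          refine le_trans (le_of_eq ?_)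
            ((pow_add_mul_le_add_pow (b := x a) hS (by have := hx a; linarith) (k + 1)).trans_eq
              (by rw [add_comm S]))
          simp only [Nat.add_sub_cancel]
          push_cast
          ring
        calc _ ≤ S ^ (k + 1) / (k + 1).factorial + x a * (S ^ k / k.factorial) :=
              add_le_add (ih (k + 1)) (mul_le_mul_of_nonneg_left (ih k) (hx a))
          _ = (S ^ (k + 1) + (k + 1) * (x a * S ^ k)) / (k + 1).factorial := by
              rw [Nat.factorial_succ]
              push_cast
              field_simp
          _ ≤ _ := by gcongr
      · intro u hu v hv huv
        have hu' : a ∉ u := fun h => ha ((Finset.mem_powersetCard.mp hu).1 h)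
        have hv' : a ∉ v := fun h => ha ((Finset.mem_powersetCard.mp hv).1 h)
        rw [← Finset.erase_insert hu', huv, Finset.erase_insert hv']
      · refine Finset.disjoint_left.mpr fun u hu hu' => ?_
        obtain ⟨v, -, rfl⟩ := Finset.mem_image.mp hu'
        exact ha ((Finset.mem_powersetCard.mp hu).1 (Finset.mem_insert_self a v))

/-- Ratio test: consecutive terms have ratio (k+2)^r B/(k+1) ≤ 2B (k+2)^{r-1}, which tends to 0. -/
theorem summable_factorial_rpow_mul_pow_div_factorial {r : ℝ} (hr : r < 1) {B : ℝ} (hB : 0 ≤ B) :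
    Summable fun k : ℕ => ((k + 1).factorial : ℝ) ^ r * B ^ k / k.factorial := by
  have hlim : Tendsto (fun k : ℕ => 2 * B * ((k : ℝ) + 2) ^ (r - 1)) atTop (𝓝 0) := by
    have h1 : Tendsto (fun k : ℕ => ((k : ℝ) + 2)) atTop atTop :=
      tendsto_atTop_add_const_right _ _ tendsto_natCast_atTop_atTop
    have h2 := (tendsto_rpow_neg_atTop (y := 1 - r) (by linarith)).comp h1
    rw [neg_sub] at h2
    simpa using h2.const_mul (2 * B)
  refine summable_of_ratio_norm_eventually_le (r := 1 / 2) (by norm_num) ?_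
  filter_upwards [hlim.eventually_le_const (show (0 : ℝ) < 1 / 2 by norm_num)] with k hk
  have hf : ∀ k : ℕ, 0 ≤ ((k + 1).factorial : ℝ) ^ r * B ^ k / k.factorial := fun k => by
    positivity
  rw [Real.norm_of_nonneg (hf _), Real.norm_of_nonneg (hf _), mul_comm (1 / 2 : ℝ)]
  refine le_trans (le_of_eq ?_) (mul_le_mul_of_nonneg_left
    ((?_ : ((k : ℝ) + 2) ^ r * B / (k + 1) ≤ _).trans hk) (hf k))
  · rw [Nat.factorial_succ (k + 1), Nat.factorial_succ k]
    push_cast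
    rw [show (k : ℝ) + 1 + 1 = k + 2 by ring, Real.mul_rpow (by positivity) (by positivity),
      pow_succ]
    field_simp
  · rw [Real.rpow_sub_one (by positivity), div_le_iff₀ (by positivity)]
    have : 0 ≤ ((k : ℝ) + 2) ^ r * B := by positivity
    have h3 : 2 * B * (((k : ℝ) + 2) ^ r / (k + 2)) * (k + 1)
        = (((k : ℝ) + 2) ^ r * B) * (2 * (k + 1) / (k + 2)) := by ring
    rw [h3]
    refine le_mul_of_one_le_right this ?_
    rw [one_le_div (by positivity)]
    have : (0 : ℝ) ≤ k := Nat.cast_nonneg k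
    linarith

theorem rpow_sum_le_sum_rpow_of_le_one {ι : Type*} (s : Finset ι) {f : ι → ℝ}
    (hf : ∀ i ∈ s, 0 ≤ f i) {r : ℝ} (hr : 0 < r) (hr₁ : r ≤ 1) :
    (∑ i ∈ s, f i) ^ r ≤ ∑ i ∈ s, f i ^ r := by
  classical
  induction s using Finset.induction_on with
  | empty => simp [Real.zero_rpow hr.ne']
  | insert a s ha ih =>
    have hs : ∀ i ∈ s, 0 ≤ f i := fun i hi => hf i (Finset.mem_insert_of_mem hi)
    rw [Finset.sum_insert ha, Finset.sum_insert ha]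
    refine (Real.rpow_add_le_add_rpow (hf a (Finset.mem_insert_self a s))
      (Finset.sum_nonneg hs) hr.le hr₁).trans ?_
    gcongr
    exact ih hs

theorem sum_filter_mem_powerset_range_succ {M : Type*} [AddCommMonoid M] (f : Finset ℕ → M)
    (ℓ : ℕ) : ∑ u ∈ (Finset.range (ℓ + 1)).powerset with ℓ ∈ u, f u
      = ∑ u ∈ (Finset.range ℓ).powerset, f (insert ℓ u) := by
  rw [Finset.sum_filter, Finset.range_add_one, Finset.sum_powerset_insert (by simp),
    Finset.sum_eq_zero, zero_add]
  · exact Finset.sum_congr rfl fun u _ => if_pos (Finset.mem_insert_self _ _)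
  · intro u hu
    rw [if_neg]
    intro h
    simpa using Finset.mem_powerset.mp hu h

variable {Γ g : ℕ → ℝ≥0}

/-- Splitting off ℓ from u leaves the factor g_ℓ^{1/r}. The remaining sum, sorted by cardinality k,
is at most a constant times ∑_k ((k+1)!)^{q/r} (CS)^k / k! with S = ∑ g_j^{1/r}, which is finite
because q < r. -/
theorem exists_sum_max_podWeights_rpow_le {q C_q : ℝ} (hC_q : 0 ≤ C_q)
    (hΓ : ∀ k : ℕ, 1 ≤ k → (Γ k : ℝ) ≤ C_q * (k.factorial : ℝ) ^ q)
    {r : ℝ} (hr : 0 < r) (hqr : q < r) (hg : Summable fun j => (g j : ℝ) ^ (1 / r))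
    {C : ℝ} (hC : 0 ≤ C) :
    ∃ T, 0 ≤ T ∧ ∀ ℓ, ∑ u ∈ (Finset.range (ℓ + 1)).powerset with ℓ ∈ u,
      (podWeights Γ g u : ℝ) ^ (1 / r) * C ^ u.card ≤ T * (g ℓ : ℝ) ^ (1 / r) := by
  set x : ℕ → ℝ := fun j => (g j : ℝ) ^ (1 / r) with hx
  have hx₀ : ∀ j, 0 ≤ x j := fun j => Real.rpow_nonneg (g j).coe_nonneg _
  set S := ∑' j, x j with hS
  have hS₀ : 0 ≤ S := tsum_nonneg hx₀
  set φ : ℕ → ℝ := fun k => (Γ (k + 1) : ℝ) ^ (1 / r) * C ^ (k + 1) with hφ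
  have hsum := summable_factorial_rpow_mul_pow_div_factorial (r := q / r)
    ((div_lt_one hr).mpr hqr) (mul_nonneg hC hS₀)
  set t : ℕ → ℝ := fun k => ((k + 1).factorial : ℝ) ^ (q / r) * (C * S) ^ k / k.factorial with ht
  have ht₀ : ∀ k, 0 ≤ t k := fun k => by positivity
  have hφt : ∀ k, φ k * (S ^ k / k.factorial) ≤ C_q ^ (1 / r) * C * t k := by
    intro k
    have h1 : (Γ (k + 1) : ℝ) ^ (1 / r) ≤ C_q ^ (1 / r) * ((k + 1).factorial : ℝ) ^ (q / r) := by
      refine (Real.rpow_le_rpow (Γ (k + 1)).coe_nonneg (hΓ (k + 1) (by omega))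
        (by positivity)).trans_eq ?_
      rw [Real.mul_rpow hC_q (by positivity), ← Real.rpow_mul (by positivity), mul_one_div]
    calc φ k * (S ^ k / k.factorial)
        ≤ (C_q ^ (1 / r) * ((k + 1).factorial : ℝ) ^ (q / r)) * C ^ (k + 1)
          * (S ^ k / k.factorial) :=
            mul_le_mul_of_nonneg_right (mul_le_mul_of_nonneg_right h1 (by positivity))
              (by positivity)
      _ = _ := by
        simp only [ht]
        rw [mul_pow, pow_succ]
        ring
  refine ⟨C_q ^ (1 / r) * C * ∑' k, t k, by positivity, fun ℓ => ?_⟩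
  rw [sum_filter_mem_powerset_range_succ]
  have h1 : ∀ u ∈ (Finset.range ℓ).powerset,
      (podWeights Γ g (insert ℓ u) : ℝ) ^ (1 / r) * C ^ (insert ℓ u).card
        = x ℓ * (φ u.card * ∏ j ∈ u, x j) := by
    intro u hu
    have hℓ : ℓ ∉ u := fun h => by simpa using Finset.mem_powerset.mp hu h
    rw [podWeights, Finset.card_insert_of_notMem hℓ, Finset.prod_insert hℓ]
    push_cast
    rw [Real.mul_rpow (by positivity) (by positivity),
      Real.mul_rpow (by positivity) (by positivity),
      ← Real.finsetProd_rpow _ _ fun i _ => (g i).coe_nonneg]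
    simp only [hφ, hx]
    ring
  rw [Finset.sum_congr rfl h1, ← Finset.mul_sum, mul_comm]
  refine mul_le_mul_of_nonneg_right ?_ (hx₀ ℓ)
  rw [Finset.sum_powerset, ← tsum_mul_left]
  refine le_trans (Finset.sum_le_sum fun k _ => ?_)
    ((hsum.mul_left _).sum_le_tsum (Finset.range ((Finset.range ℓ).card + 1))
      fun k _ => mul_nonneg (by positivity) (ht₀ k))
  refine le_trans ?_ (hφt k)
  have h2 : ∑ u ∈ (Finset.range ℓ).powersetCard k, φ u.card * ∏ j ∈ u, x j
      = φ k * ∑ u ∈ (Finset.range ℓ).powersetCard k, ∏ j ∈ u, x j := by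
    rw [Finset.mul_sum]
    exact Finset.sum_congr rfl fun u hu => by rw [(Finset.mem_powersetCard.mp hu).2]
  rw [h2]
  refine mul_le_mul_of_nonneg_left ((sum_powersetCard_prod_le hx₀ _ k).trans ?_) (by positivity)
  gcongr
  exact hg.sum_le_tsum _ fun j _ => hx₀ j

/-- The sums `(∑_{max u = ℓ} γ_u^{1/t} C^{|u|})^t` are bounded by a multiple of `γ_ℓ`. -/
theorem exists_rpow_sum_max_podWeights_le {q C_q : ℝ} (hC_q : 0 ≤ C_q)
    (hΓ : ∀ k : ℕ, 1 ≤ k → (Γ k : ℝ) ≤ C_q * (k.factorial : ℝ) ^ q)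
    {r : ℝ} (hqr : q < r) (hg : Summable fun j => (g j : ℝ) ^ (1 / r))
    {t : ℝ} (ht : 0 < t) (htr : t ≤ r) {C : ℝ} (hC : 0 ≤ C) :
    ∃ T, 0 ≤ T ∧ ∀ ℓ, (∑ u ∈ (Finset.range (ℓ + 1)).powerset with ℓ ∈ u,
      (podWeights Γ g u : ℝ) ^ (1 / t) * C ^ u.card) ^ t ≤ T * (g ℓ : ℝ) := by
  have hr : 0 < r := ht.trans_le htr
  -- Since q ≥ t is possible, the previous lemma cannot be used with t itself. Subadditivity of the
  -- power t/r ≤ 1 passes to the exponent r > q, turning C into C^{t/r}; raising to the power r then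
  -- undoes the change.
  obtain ⟨T, hT, hTle⟩ := exists_sum_max_podWeights_rpow_le hC_q hΓ hr hqr hg
    (C := C ^ (t / r)) (by positivity)
  refine ⟨T ^ r, by positivity, fun ℓ => ?_⟩
  have hterm : ∀ u : Finset ℕ, 0 ≤ (podWeights Γ g u : ℝ) ^ (1 / t) * C ^ u.card := fun u => by
    positivity
  have h1 : (∑ u ∈ (Finset.range (ℓ + 1)).powerset with ℓ ∈ u,
      (podWeights Γ g u : ℝ) ^ (1 / t) * C ^ u.card) ^ (t / r) ≤ T * (g ℓ : ℝ) ^ (1 / r) := by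
    refine (rpow_sum_le_sum_rpow_of_le_one _ (fun u _ => hterm u) (by positivity)
      ((div_le_one hr).mpr htr)).trans (le_trans (le_of_eq ?_) (hTle ℓ))
    refine Finset.sum_congr rfl fun u _ => ?_
    rw [Real.mul_rpow (by positivity) (by positivity), ← Real.rpow_mul (by positivity),
      ← Real.rpow_natCast, ← Real.rpow_natCast, ← Real.rpow_mul hC, ← Real.rpow_mul hC,
      mul_comm (u.card : ℝ)]
    congr 2
    field_simp
  have h0 := Finset.sum_nonneg fun u (_ : u ∈ (Finset.range (ℓ + 1)).powerset.filter (ℓ ∈ ·)) =>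
    hterm u
  have h2 := Real.rpow_le_rpow (Real.rpow_nonneg h0 _) h1 hr.le
  rw [← Real.rpow_mul h0, div_mul_cancel₀ _ hr.ne', Real.mul_rpow hT (by positivity),
    ← Real.rpow_mul (by positivity), one_div_mul_cancel hr.ne', Real.rpow_one] at h2
  exact h2

theorem sum_finset_le_of_sum_max_le {f : Finset ℕ → ℝ} (hf : ∀ u, 0 ≤ f u) {b : ℕ → ℝ}
    (hb : Summable b)
    (hfb : ∀ ℓ, ∑ u ∈ (Finset.range (ℓ + 1)).powerset with ℓ ∈ u, f u ≤ b ℓ)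
    (F : Finset (Finset ℕ)) : ∑ u ∈ F, f u ≤ f ∅ + ∑' ℓ, b ℓ := by
  have hb₀ : ∀ ℓ, 0 ≤ b ℓ := fun ℓ => (Finset.sum_nonneg fun u _ => hf u).trans (hfb ℓ)
  rw [← ENNReal.ofReal_le_ofReal_iff (add_nonneg (hf ∅) (tsum_nonneg hb₀)),
    ENNReal.ofReal_sum_of_nonneg fun u _ => hf u, ENNReal.ofReal_add (hf ∅) (tsum_nonneg hb₀),
    ENNReal.ofReal_tsum_of_nonneg hb₀ hb]
  refine (ENNReal.sum_le_tsum F).trans ((tsum_finset_nat_le _).trans ?_)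
  gcongr with ℓ
  rw [← ENNReal.ofReal_sum_of_nonneg fun u _ => hf u]
  exact ENNReal.ofReal_le_ofReal (hfb ℓ)

end Weights

/-! ### Non-increasing rearrangements of weights. -/

section SortedValue

variable {A A' : Set (Finset ℕ)} {w w' : Finset ℕ → ℝ}

theorem sortedValue_nonneg (hw : ∀ u ∈ A, 0 ≤ w u) (j : ℕ) : 0 ≤ sortedValue A w j := by
  rcases Set.eq_empty_or_nonempty {t : ℝ | ∃ F : Finset (Finset ℕ), F.card = j + 1 ∧
    ∀ u ∈ F, u ∈ A ∧ t ≤ w u} with h | ⟨t, F, hF, hFt⟩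
  · rw [sortedValue, h, Real.sSup_empty]
  · exact Real.sSup_nonneg' ⟨0, ⟨F, hF, fun u hu => ⟨(hFt u hu).1, hw u (hFt u hu).1⟩⟩, le_rfl⟩

/-- The bound W matters: the real supremum of an unbounded set is 0 by convention. -/
theorem le_sortedValue {W : ℝ} (hW : ∀ u ∈ A, w u ≤ W) {F : Finset (Finset ℕ)} {j : ℕ}
    (hF : F.card = j + 1) {t : ℝ} (hFt : ∀ u ∈ F, u ∈ A ∧ t ≤ w u) : t ≤ sortedValue A w j := by
  refine le_csSup ⟨W, ?_⟩ ⟨F, hF, hFt⟩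
  rintro t ⟨F, hF, hFt⟩
  obtain ⟨u, hu⟩ := Finset.card_pos.mp (by omega : 0 < F.card)
  exact (hFt u hu).2.trans (hW u (hFt u hu).1)

theorem sortedValue_mono (hA : A ⊆ A') (hw : ∀ u ∈ A, w u ≤ w' u) (hw₀ : ∀ u ∈ A', 0 ≤ w' u)
    {W : ℝ} (hW : ∀ u ∈ A', w' u ≤ W) (j : ℕ) : sortedValue A w j ≤ sortedValue A' w' j := by
  refine Real.sSup_le ?_ (sortedValue_nonneg hw₀ j)
  rintro t ⟨F, hF, hFt⟩
  exact le_sortedValue hW hF fun u hu =>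
    ⟨hA (hFt u hu).1, (hFt u hu).2.trans (hw u (hFt u hu).1)⟩

/-- If j+1 of the values are at least t > 0, then (j+1) t^{1/r} ≤ S. -/
theorem sortedValue_le_rpow {r S : ℝ} (hr : 0 < r) (hS : 0 ≤ S)
    (hwS : ∀ F : Finset (Finset ℕ), ∑ u ∈ F, w u ^ (1 / r) ≤ S) (j : ℕ) :
    sortedValue A w j ≤ (S / (j + 1)) ^ r := by
  refine Real.sSup_le ?_ (by positivity)
  rintro t ⟨F, hF, hFt⟩
  rcases le_or_gt t 0 with ht | ht
  · exact ht.trans (by positivity)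
  · have h1 : ((j : ℝ) + 1) * t ^ (1 / r) ≤ S := by
      refine le_trans ?_ (hwS F)
      have := Finset.card_nsmul_le_sum F (fun u => w u ^ (1 / r)) (t ^ (1 / r)) fun u hu =>
        Real.rpow_le_rpow ht.le (hFt u hu).2 (by positivity)
      rw [hF, nsmul_eq_mul] at this
      exact_mod_cast this
    have h2 : t ^ (1 / r) ≤ S / (j + 1) := by
      rw [le_div_iff₀ (by positivity)]
      linarith
    have h3 := Real.rpow_le_rpow (by positivity) h2 hr.le
    rwa [← Real.rpow_mul ht.le, one_div_mul_cancel hr.ne', Real.rpow_one] at h3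

end SortedValue

/-! ### Decay of the weights. -/

section Decay

variable {Γ g : ℕ → ℝ≥0} {C₀ : ℝ}

/-- By monotonicity the singletons {0}, …, {j} all have weight at least g_j, so the (j+1)-st largest
value is at least g_j C₀; the limit defining the decay bounds it. -/
theorem exists_le_rpow_of_lt_decay (hg : Antitone g) (hΓ₁ : Γ 1 = 1) (hC₀ : 0 < C₀) {β : ℝ}
    (hβ : (β : EReal) < decay C₀ (podWeights Γ g) 1) :
    ∃ A, 0 ≤ A ∧ ∀ j : ℕ, (g j : ℝ) ≤ A * ((j : ℝ) + 1) ^ (-β) := by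
  rw [decay, lt_iSup_iff] at hβ
  obtain ⟨p, hp⟩ := hβ
  rw [lt_iSup_iff] at hp
  obtain ⟨hlim, hp⟩ := hp
  rw [EReal.coe_lt_coe_iff] at hp
  obtain ⟨A, hA⟩ := hlim.bddAbove_range
  have hA' := fun j => hA (Set.mem_range_self j)
  have hsing : ∀ i : ℕ, (cutoffWeights (podWeights Γ g) 1 {i} : ℝ) = g i := fun i => by
    simp [cutoffWeights, podWeights, hΓ₁]
  have hW : ∀ u ∈ {u : Finset ℕ | u.Nonempty ∧ 0 < cutoffWeights (podWeights Γ g) 1 u},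
      (cutoffWeights (podWeights Γ g) 1 u : ℝ) * C₀ ^ u.card ≤ g 0 * C₀ := by
    rintro u ⟨hu, hpos⟩
    have hcard : u.card ≤ 1 := by
      by_contra h
      rw [cutoffWeights, if_neg (by exact_mod_cast h)] at hpos
      exact lt_irrefl _ hpos
    obtain ⟨i, rfl⟩ := Finset.card_eq_one.mp (le_antisymm hcard hu.card_pos)
    rw [hsing, Finset.card_singleton, pow_one]
    exact mul_le_mul_of_nonneg_right (by exact_mod_cast hg (Nat.zero_le i)) hC₀.le
  have key : ∀ j : ℕ, (g j : ℝ) * C₀ * ((j : ℝ) + 1) ^ p ≤ max A 0 := by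
    intro j
    rcases eq_or_ne (g j) 0 with h0 | h0
    · simp [h0]
    refine le_trans ?_ ((hA' j).trans (le_max_left _ _))
    refine mul_le_mul_of_nonneg_right ?_ (by positivity)
    refine le_sortedValue hW (F := (Finset.range (j + 1)).image fun i => {i}) ?_ ?_
    · rw [Finset.card_image_of_injective _ Finset.singleton_injective, Finset.card_range]
    · intro u hu
      obtain ⟨i, hi, rfl⟩ := Finset.mem_image.mp hu
      have hgi : g j ≤ g i := hg (Nat.lt_succ_iff.mp (Finset.mem_range.mp hi))
      refine ⟨⟨Finset.singleton_nonempty i, ?_⟩, ?_⟩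
      · rw [← NNReal.coe_pos, hsing]
        exact_mod_cast (pos_iff_ne_zero.mpr h0).trans_le hgi
      · rw [hsing, Finset.card_singleton, pow_one]
        exact mul_le_mul_of_nonneg_right (by exact_mod_cast hgi) hC₀.le
  refine ⟨max A 0 / C₀, by positivity, fun j => ?_⟩
  have h1 : (1 : ℝ) ≤ (j : ℝ) + 1 := by
    have : (0 : ℝ) ≤ j := Nat.cast_nonneg j
    linarith
  calc (g j : ℝ) = (g j * C₀ * ((j : ℝ) + 1) ^ p) / C₀ * ((j : ℝ) + 1) ^ (-p) := by
        rw [Real.rpow_neg (by positivity)]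
        field_simp
    _ ≤ max A 0 / C₀ * ((j : ℝ) + 1) ^ (-β) := by
        have := key j
        gcongr

theorem summable_rpow_of_lt_decay (hg : Antitone g) (hΓ₁ : Γ 1 = 1) (hC₀ : 0 < C₀) {r : ℝ}
    (hr₀ : 0 < r) (hr : (r : EReal) < decay C₀ (podWeights Γ g) 1) :
    Summable fun j => (g j : ℝ) ^ (1 / r) := by
  obtain ⟨β, hrβ, hβ⟩ := EReal.lt_iff_exists_real_btwn.mp hr
  rw [EReal.coe_lt_coe_iff] at hrβ
  obtain ⟨A, hA, hgA⟩ := exists_le_rpow_of_lt_decay hg hΓ₁ hC₀ hβ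
  have hs : Summable fun j : ℕ => A ^ (1 / r) * (((j + 1 : ℕ) : ℝ) ^ (-(β / r))) := by
    have h : Summable fun j : ℕ => (j : ℝ) ^ (-(β / r)) := by
      rw [Real.summable_nat_rpow, neg_lt_neg_iff]
      exact (one_lt_div hr₀).mpr hrβ
    exact ((summable_nat_add_iff 1).mpr h).mul_left _
  refine Summable.of_nonneg_of_le (fun j => by positivity) (fun j => ?_) hs
  refine (Real.rpow_le_rpow (g j).coe_nonneg (hgA j) (by positivity)).trans_eq ?_
  rw [Real.mul_rpow hA (by positivity), ← Real.rpow_mul (by positivity)]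
  push_cast
  congr 2
  ring

/-- For POD weights, higher order weights do not decrease the decay. -/
theorem decay_top_podWeights (hg : Antitone g) (hΓ₁ : Γ 1 = 1) (hC₀ : 0 < C₀)
    (hδ : 1 < decay C₀ (podWeights Γ g) 1) {q C_q : ℝ}
    (hq : (q : EReal) < decay C₀ (podWeights Γ g) 1) (hC_q : 0 ≤ C_q)
    (hΓ : ∀ k : ℕ, 1 ≤ k → (Γ k : ℝ) ≤ C_q * (k.factorial : ℝ) ^ q) :
    decay C₀ (podWeights Γ g) ⊤ = decay C₀ (podWeights Γ g) 1 := by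
  set γ := podWeights Γ g with hγ
  have hcut : cutoffWeights γ ⊤ = γ := by
    funext u
    simp [cutoffWeights]
  have hw₀ : ∀ u : Finset ℕ, 0 ≤ (γ u : ℝ) * C₀ ^ u.card := fun u => by positivity
  -- The weights of all orders are 1/r-summable for every positive r strictly between q and δ. This
  -- gives the decay rate r, and in particular boundedness.
  have hbound : ∀ r : ℝ, 0 < r → q < r → (r : EReal) < decay C₀ γ 1 → ∃ S, 0 ≤ S ∧
      ∀ F : Finset (Finset ℕ), ∑ u ∈ F, ((γ u : ℝ) * C₀ ^ u.card) ^ (1 / r) ≤ S := by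
    intro r hr₀ hqr hr
    have hs := summable_rpow_of_lt_decay hg hΓ₁ hC₀ hr₀ hr
    obtain ⟨T, hT, hTle⟩ := exists_sum_max_podWeights_rpow_le hC_q hΓ hr₀ hqr hs
      (C := C₀ ^ (1 / r)) (by positivity)
    have heq : ∀ u : Finset ℕ, ((γ u : ℝ) * C₀ ^ u.card) ^ (1 / r)
        = (γ u : ℝ) ^ (1 / r) * (C₀ ^ (1 / r)) ^ u.card := fun u => by
      rw [Real.mul_rpow (by positivity) (by positivity), ← Real.rpow_natCast,
        ← Real.rpow_natCast, ← Real.rpow_mul hC₀.le, ← Real.rpow_mul hC₀.le, mul_comm (1 / r)]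
    refine ⟨((γ ∅ : ℝ) * C₀ ^ (∅ : Finset ℕ).card) ^ (1 / r) + ∑' ℓ, T * (g ℓ : ℝ) ^ (1 / r),
      by positivity, fun F => sum_finset_le_of_sum_max_le (fun u => by positivity)
      (hs.mul_left T) (fun ℓ => ?_) F⟩
    simp_rw [heq]
    exact hTle ℓ
  refine le_antisymm ?_ ?_
  · obtain ⟨r, hr, hrδ⟩ := EReal.lt_iff_exists_real_btwn.mp (max_lt hδ hq)
    have hr₁ : 1 < r := by exact_mod_cast (le_max_left _ _).trans_lt hr
    have hqr : q < r := by exact_mod_cast (le_max_right _ _).trans_lt hr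
    obtain ⟨S, hS, hSle⟩ := hbound r (by linarith) hqr hrδ
    have hW : ∀ u : Finset ℕ, (γ u : ℝ) * C₀ ^ u.card ≤ S ^ r := by
      intro u
      have h1 := hSle {u}
      rw [Finset.sum_singleton] at h1
      have h2 := Real.rpow_le_rpow (by positivity) h1 (by linarith : 0 ≤ r)
      rwa [← Real.rpow_mul (hw₀ u), one_div_mul_cancel (by linarith), Real.rpow_one] at h2
    refine iSup₂_le fun p hp => ?_
    rw [hcut] at hp
    refine le_iSup₂_of_le p ?_ le_rfl
    have hle : ∀ u : Finset ℕ, cutoffWeights γ 1 u ≤ γ u := fun u => by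
      rw [cutoffWeights]
      split_ifs
      · exact le_rfl
      · exact bot_le
    refine squeeze_zero (fun j => mul_nonneg (sortedValue_nonneg (fun u _ => by positivity) j)
      (by positivity)) (fun j => ?_) hp
    have hsub : {u : Finset ℕ | u.Nonempty ∧ 0 < cutoffWeights γ 1 u}
        ⊆ {u | u.Nonempty ∧ 0 < γ u} := fun u hu => ⟨hu.1, hu.2.trans_le (hle u)⟩
    refine mul_le_mul_of_nonneg_right (sortedValue_mono hsub (fun u _ => ?_) (fun u _ => hw₀ u)
      (fun u _ => hW u) j) (by positivity)
    exact mul_le_mul_of_nonneg_right (by exact_mod_cast hle u) (by positivity)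
  · refine le_of_forall_lt fun x hx => ?_
    obtain ⟨p, hp, hpδ⟩ := EReal.lt_iff_exists_real_btwn.mp (max_lt hx (max_lt hδ hq))
    obtain ⟨r, hpr, hrδ⟩ := EReal.lt_iff_exists_real_btwn.mp hpδ
    rw [EReal.coe_lt_coe_iff] at hpr
    have hp₁ : 1 < p := by
      exact_mod_cast ((le_max_left _ _).trans (le_max_right _ _)).trans_lt hp
    have hqp : q < p := by
      exact_mod_cast ((le_max_right _ _).trans (le_max_right _ _)).trans_lt hp
    refine ((le_max_left _ _).trans_lt hp).trans_le ?_
    obtain ⟨S, hS, hSle⟩ := hbound r (by linarith) (hqp.trans hpr) hrδ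
    refine le_iSup₂_of_le p ?_ le_rfl
    rw [hcut]
    have hlim : Tendsto (fun j : ℕ => S ^ r * ((j : ℝ) + 1) ^ (-(r - p))) atTop (𝓝 0) := by
      have h1 : Tendsto (fun j : ℕ => ((j : ℝ) + 1)) atTop atTop :=
        tendsto_atTop_add_const_right _ _ tendsto_natCast_atTop_atTop
      have h2 := (tendsto_rpow_neg_atTop (y := r - p) (by linarith)).comp h1
      simpa using h2.const_mul (S ^ r)
    refine squeeze_zero (fun j => mul_nonneg (sortedValue_nonneg (fun u _ => hw₀ u) j)
      (by positivity)) (fun j => ?_) hlim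
    refine (mul_le_mul_of_nonneg_right (sortedValue_le_rpow (by linarith) hS hSle j)
      (by positivity)).trans_eq ?_
    rw [Real.div_rpow hS (by positivity), neg_sub, Real.rpow_sub (by positivity)]
    ring

end Decay

/-! ### Growth of the level dimensions. -/

section LevelDim

/-- The summand 1 makes the bound hold also for k = 0, where L_0 = 0. -/
theorem pow_le_mul_levelDim_add_one {L : ℕ} (hL : 1 ≤ L) {a : ℝ} (ha : 1 < a) (k : ℕ) :
    a ^ k ≤ a * ((levelDim L a k : ℝ) + 1) := by
  have ha₀ : 0 < a := by linarith
  cases k with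
  | zero =>
    simp [levelDim]
    exact ha.le
  | succ k =>
    rw [pow_succ, mul_comm]
    refine mul_le_mul_of_nonneg_left ?_ ha₀.le
    have h1 : a ^ k ≤ ⌈a ^ k⌉₊ := Nat.le_ceil _
    have h2 : ((⌈a ^ k⌉₊ : ℕ) : ℝ) ≤ levelDim L a (k + 1) := by
      exact_mod_cast Nat.le_mul_of_pos_left _ hL
    linarith

theorem ceil_le_two_mul {x : ℝ} (hx : 1 ≤ x) : ((⌈x⌉₊ : ℕ) : ℝ) ≤ 2 * x := by
  have := Nat.ceil_lt_add_one (by linarith : 0 ≤ x)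
  linarith

theorem levelDim_succ_le (L : ℕ) {a : ℝ} (ha : 1 < a) (k : ℕ) :
    (levelDim L a (k + 1) : ℝ) ≤ 2 * L * a ^ k := by
  have h := ceil_le_two_mul (one_le_pow₀ ha.le : 1 ≤ a ^ k)
  rw [levelDim]
  push_cast
  calc (L : ℝ) * ⌈a ^ k⌉₊ ≤ L * (2 * a ^ k) := by gcongr
    _ = _ := by ring

theorem one_le_levelDim_succ {L : ℕ} (hL : 1 ≤ L) {a : ℝ} (ha : 1 < a) (k : ℕ) :
    1 ≤ levelDim L a (k + 1) := by
  have : 0 < ⌈a ^ k⌉₊ := Nat.ceil_pos.mpr (by positivity)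
  exact Nat.mul_pos hL this

/-- A convolution of two geometric sequences is dominated by the larger ratio. It is applied to the
error sum and to the cost sum. -/
theorem sum_pow_mul_pow_le {u v : ℝ} (hv : 0 ≤ v) (huv : v < u) (m : ℕ) :
    ∑ k ∈ Finset.range m, u ^ k * v ^ (m - 1 - k) ≤ u ^ m / (u - v) := by
  rw [le_div_iff₀ (by linarith), geom_sum₂_mul]
  have := pow_nonneg hv m
  linarith

end LevelDim

/-! ### Cost of multilevel algorithms. -/

section NestedCost

variable {E : Type} {cost : ℕ → ℝ} {c : E}

theorem pointCost_range_le {x : ℕ → E} {N : ℕ} (h : ∀ j ∉ Finset.range N, x j = c) :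
    pointCost cost c Finset.range x ≤ ENNReal.ofReal (cost N) :=
  iInf₂_le_of_le N h (by rw [Finset.card_range])

theorem sum_pointCost_range_le {Q : SamplingRule E} {N : ℕ}
    (h : ∀ p ∈ Q, ∀ j ∉ Finset.range N, p.2 j = c) :
    (Q.map fun p => pointCost cost c Finset.range p.2).sum
      ≤ (Q.length : ℝ≥0∞) * ENNReal.ofReal (cost N) := by
  refine (List.sum_le_card_nsmul _ (ENNReal.ofReal (cost N)) ?_).trans_eq
    (by rw [List.length_map, nsmul_eq_mul])
  intro y hy
  obtain ⟨p, hp, rfl⟩ := List.mem_map.mp hy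
  exact pointCost_range_le (h p hp)

/-- The nested sequence of all initial segments contains every v_k. The factor 2 counts the two
evaluations in f - f((·)_{v_{k-1}}; c). -/
theorem nestedCost_multilevelRule_le (hcost : ∀ k, 0 ≤ cost k) {L : ℕ} {a : ℝ} (ha : 1 < a)
    {Q : ℕ → SamplingRule E} {m : ℕ} {n : ℕ → ℕ} (hn : ∀ k < m, (Q (k + 1)).length = n (k + 1))
    (hQ : ∀ k < m, ∀ p ∈ Q (k + 1), ∀ j ∉ levelSet L a (k + 1), p.2 j = c) :
    nestedCost cost c (multilevelRule c L a Q m) ≤ ENNReal.ofReal (cost 0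
      + ∑ k ∈ Finset.range m, 2 * n (k + 1) * cost (levelDim L a (k + 1))) := by
  refine iInf₂_le_of_le Finset.range (strictMono_nat_of_lt_succ fun k => ?_) ?_
  · rw [Finset.range_add_one]
    exact Finset.ssubset_insert (by simp)
  rw [ENNReal.ofReal_add (hcost 0) (Finset.sum_nonneg fun k _ => mul_nonneg (by positivity)
    (hcost _)), ENNReal.ofReal_sum_of_nonneg fun k _ => mul_nonneg (by positivity) (hcost _),
    multilevelRule, List.map_cons, List.sum_cons]
  refine add_le_add (pointCost_range_le fun j _ => rfl) ?_
  have key : ∀ m' ≤ m, (((List.range m').flatMap fun k =>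
      Q (k + 1) ++ (Q (k + 1)).map fun p => (-p.1, anchorOutside c (levelSet L a k) p.2)).map
      fun p => pointCost cost c Finset.range p.2).sum ≤ ∑ k ∈ Finset.range m',
        ENNReal.ofReal (2 * n (k + 1) * cost (levelDim L a (k + 1))) := by
    intro m' hm'
    induction m' with
    | zero => simp
    | succ k ih =>
      rw [List.range_succ, List.flatMap_append, List.map_append, List.sum_append,
        Finset.sum_range_succ]
      refine add_le_add (ih (by omega)) ?_
      rw [List.flatMap_singleton]
      have hpts : ∀ p ∈ Q (k + 1) ++ (Q (k + 1)).map
          (fun p => (-p.1, anchorOutside c (levelSet L a k) p.2)),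
          ∀ j ∉ Finset.range (levelDim L a (k + 1)), p.2 j = c := by
        intro p hp j hj
        rcases List.mem_append.mp hp with hp | hp
        · exact hQ k (by omega) p hp j hj
        · obtain ⟨p', -, rfl⟩ := List.mem_map.mp hp
          exact anchorOutside_of_notMem fun h => hj (monotone_levelSet L ha (Nat.le_succ k) h)
      refine (sum_pointCost_range_le hpts).trans_eq ?_
      rw [List.length_append, List.length_map, hn k (by omega), ENNReal.ofReal_mul (by positivity),
        ← ENNReal.ofReal_natCast]
      congr 2
      push_cast
      ring
  exact key m le_rfl

/-- The freedom to enlarge the exponent is what later merges all parameter regimes into one. -/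
theorem exists_cost_le_rpow (hcost_mono : Monotone cost) (hcost_one : ∀ k, 1 ≤ cost k) {s s' : ℝ}
    (hcost : (fun k : ℕ => cost k) =O[atTop] fun k : ℕ => (k : ℝ) ^ s) (hs : s ≤ s')
    (hs' : 0 ≤ s') : ∃ B, 0 ≤ B ∧ ∀ k : ℕ, 1 ≤ k → cost k ≤ B * (k : ℝ) ^ s' := by
  obtain ⟨B, hB⟩ := hcost.bound
  obtain ⟨N, hN⟩ := eventually_atTop.mp hB
  refine ⟨max B (cost N), (zero_le_one.trans (hcost_one N)).trans (le_max_right _ _),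
    fun k hk => ?_⟩
  have hk' : (1 : ℝ) ≤ k := by exact_mod_cast hk
  rcases le_total N k with h | h
  · have h1 := hN k h
    rw [Real.norm_of_nonneg (zero_le_one.trans (hcost_one k)),
      Real.norm_of_nonneg (by positivity)] at h1
    have h2 : (0 : ℝ) ≤ max B (cost N) :=
      (zero_le_one.trans (hcost_one N)).trans (le_max_right _ _)
    refine h1.trans ((mul_le_mul_of_nonneg_right (le_max_left B (cost N)) (by positivity)).trans ?_)
    exact mul_le_mul_of_nonneg_left (Real.rpow_le_rpow_of_exponent_le hk' hs) h2
  · refine (hcost_mono h).trans ((le_max_right B _).trans ?_)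
    exact le_mul_of_one_le_right ((zero_le_one.trans (hcost_one N)).trans (le_max_right _ _))
      (Real.one_le_rpow hk' hs')

end NestedCost

/-- Take the least m with Tθ^m ≤ ε². If m > 0, minimality gives θ^{m-1} > ε²/T, and raising this to
the power -x bounds z^{m-1}. If m = 0, the constant 1 in the maximum suffices. -/
theorem exists_nat_mul_pow_le_and_pow_le {T θ z x : ℝ} (hT : 0 < T) (hθ₀ : 0 < θ) (hθ₁ : θ < 1)
    (hz : z = θ ^ (-x)) (hx : 0 ≤ x) {ε : ℝ} (hε : 0 < ε) (hε₁ : ε ≤ 1) :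
    ∃ m : ℕ, T * θ ^ m ≤ ε ^ 2 ∧ z ^ m ≤ max 1 (z * T ^ x) * ε ^ (-(2 * x)) := by
  have hex : ∃ m : ℕ, T * θ ^ m ≤ ε ^ 2 := by
    obtain ⟨m, hm⟩ := exists_pow_lt_of_lt_one (show 0 < ε ^ 2 / T by positivity) hθ₁
    refine ⟨m, ?_⟩
    rw [lt_div_iff₀ hT] at hm
    linarith
  classical
  refine ⟨Nat.find hex, Nat.find_spec hex, ?_⟩
  have hz₀ : 0 < z := hz ▸ Real.rpow_pos_of_pos hθ₀ _
  have hεx : 1 ≤ ε ^ (-(2 * x)) := Real.one_le_rpow_of_pos_of_le_one_of_nonpos hε hε₁ (by linarith)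
  rcases hm : Nat.find hex with _ | j
  · rw [pow_zero]
    exact one_le_mul_of_one_le_of_one_le (le_max_left _ _) hεx
  · have h1 := Nat.find_min hex (m := j) (by omega)
    push Not at h1
    have h2 : ε ^ 2 / T ≤ θ ^ j := by
      rw [div_le_iff₀ hT]
      linarith
    have h3 : z ^ j ≤ T ^ x * ε ^ (-(2 * x)) := by
      rw [hz, ← Real.rpow_natCast, ← Real.rpow_mul hθ₀.le, mul_comm, Real.rpow_mul hθ₀.le,
        Real.rpow_natCast]
      refine (Real.rpow_le_rpow_of_nonpos (by positivity) h2 (by linarith)).trans_eq ?_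
      rw [Real.div_rpow (by positivity) hT.le, Real.rpow_neg hT.le, div_inv_eq_mul, mul_comm,
        ← Real.rpow_natCast, ← Real.rpow_mul hε.le]
      congr 2
      push_cast
      ring
    rw [pow_succ, mul_comm]
    calc z * z ^ j ≤ z * (T ^ x * ε ^ (-(2 * x))) := by gcongr
      _ = (z * T ^ x) * ε ^ (-(2 * x)) := by ring
      _ ≤ _ := by gcongr; exact le_max_right _ _

/-! ### From tail bounds to achieved exponents. -/

section Achieves

variable {E : Type} [MeasurableSpace E] {K : ScalarKernel E} {c : E} {ρ : Measure E}

/-- The exponent asks for a bound for all ε > 0, the algorithms provide it for ε ≤ 1. The empty rule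
is free once ε reaches the initial error e₀; for 1 < ε < e₀ the algorithm for ε = 1 serves, at the
price of a factor e₀^p. -/
theorem nestedExponent_le_of_multilevelAchieves {γ : Finset ℕ → ℝ≥0}
    (hfin : worstCaseError K ρ γ [] ≠ ⊤) {cost : ℕ → ℝ} {L : ℕ} {a : ℝ} {α : ℝ} {δ b : EReal}
    (hb : 0 ≤ b)
    (h : ∀ p : ℝ, b < (p : EReal) → MultilevelAchieves cost c K ρ γ L a α δ p) :
    nestedExponent cost c K ρ γ ≤ b := by
  refine EReal.le_of_forall_lt_iff_le.mp fun p hp => ?_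
  have hp₀ : 0 ≤ p := by exact_mod_cast hb.trans hp.le
  obtain ⟨τ, C, -, ⟨-, hquad⟩, B, hB⟩ := h p hp
  have hsmall : ∀ ε : ℝ, 0 < ε → ε ≤ 1 → ∀ ε' : ℝ, ε ≤ ε' →
      nestedComplexity cost c K ρ γ ε' ≤ ENNReal.ofReal (B * ε ^ (-p)) := by
    intro ε hε hε₁ ε' hεε'
    obtain ⟨m, n, -, hn₁, hQ⟩ := hB ε hε hε₁
    have hex : ∀ k, ∃ Q, k ∈ Set.Icc 1 m → IsLevelQuadrature c K ρ γ L a τ C k (n k) Q := by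
      intro k
      by_cases hk : k ∈ Set.Icc 1 m
      · obtain ⟨Q, hQ⟩ := hquad k (n k) hk.1 (hn₁ k hk)
        exact ⟨Q, fun _ => hQ⟩
      · exact ⟨[], fun h => absurd h hk⟩
    choose Q hQ' using hex
    obtain ⟨h1, h2⟩ := hQ Q hQ'
    exact iInf₂_le_of_le (multilevelRule c L a Q m) ⟨admissible_multilevelRule fun k hk =>
      (hQ' (k + 1) ⟨by omega, by omega⟩).2.1, h1.trans (ENNReal.ofReal_le_ofReal hεε')⟩ h2
  set e₀ := (worstCaseError K ρ γ []).toReal with he₀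
  have hB₀ : (0 : ℝ) ≤ max B 0 := le_max_right _ _
  refine iInf₂_le p ⟨hp₀, max B 0 * max 1 (e₀ ^ p), by positivity, fun ε hε => ?_⟩
  rcases le_or_gt ε 1 with hε₁ | hε₁
  · refine (hsmall ε hε hε₁ ε le_rfl).trans (ENNReal.ofReal_le_ofReal ?_)
    refine mul_le_mul_of_nonneg_right ?_ (by positivity)
    exact (le_max_left B 0).trans (le_mul_of_one_le_right hB₀ (le_max_left _ _))
  rcases le_or_gt e₀ ε with he | he
  · have h0 : nestedComplexity cost c K ρ γ ε ≤ 0 := by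
      refine iInf₂_le_of_le [] ⟨fun p hp => absurd hp (by simp), ?_⟩ ?_
      · rw [← ENNReal.ofReal_toReal hfin]
        exact ENNReal.ofReal_le_ofReal he
      · refine iInf₂_le_of_le Finset.range (strictMono_nat_of_lt_succ fun k => ?_) (by simp)
        rw [Finset.range_add_one]
        exact Finset.ssubset_insert (by simp)
    exact h0.trans bot_le
  · refine (hsmall 1 one_pos le_rfl ε hε₁.le).trans (ENNReal.ofReal_le_ofReal ?_)
    rw [Real.one_rpow, mul_one, mul_assoc]
    refine (le_max_left B 0).trans (le_mul_of_one_le_right hB₀ ?_)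
    calc (1 : ℝ) = ε ^ p * ε ^ (-p) := by
          rw [← Real.rpow_add hε, add_neg_cancel, Real.rpow_zero]
      _ ≤ max 1 (e₀ ^ p) * ε ^ (-p) := by
          gcongr
          exact (Real.rpow_le_rpow hε.le he.le hp₀).trans (le_max_right _ _)

variable [IsProbabilityMeasure ρ]

/-- The choice of the parameters of the multilevel algorithms. -/
theorem multilevelAchieves_of_tail_le (hK : Measurable (Function.uncurry K.toFun))
    (hM : Integrable (fun x => K x x) ρ) (hc : K c c = 0) (hC₀ : 0 ≤ meanConstant K ρ)
    {cost : ℕ → ℝ} (hcost₀ : ∀ k, 0 ≤ cost k) {s B₁ : ℝ} (hs : 0 < s) (hB₁ : 0 ≤ B₁)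
    (hcost : ∀ k : ℕ, 1 ≤ k → cost k ≤ B₁ * (k : ℝ) ^ s)
    {γ : Finset ℕ → ℝ≥0}
    (hsum : Summable fun u : Finset ℕ => (γ u : ℝ) * diagonalConstant K ρ ^ u.card)
    {L : ℕ} (hL : 1 ≤ L) {a : ℝ} (ha : 1 < a) {α τ C : ℝ} {δ : EReal}
    (hτ : AdmissibleTau α δ τ) (hquad : HasLevelQuadratures c K ρ γ L a τ C) (hτ₀ : 0 < τ)
    {b : ℕ → ℝ} (hb : Summable b)
    (hb₁ : ∀ ℓ, (∑ u ∈ (Finset.range (ℓ + 1)).powerset with ℓ ∈ u,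
      (γ u : ℝ) ^ (1 / (2 * τ)) * C ^ u.card) ^ (2 * τ) ≤ b ℓ)
    (hb₂ : ∀ ℓ, ∑ u ∈ (Finset.range (ℓ + 1)).powerset with ℓ ∈ u,
      (γ u : ℝ) * meanConstant K ρ ^ u.card ≤ b ℓ)
    {κ T : ℝ} (hκ : 0 < κ) (hκs : κ < 2 * τ * s) (hT : 0 < T)
    (htail : ∀ N : ℕ, ∑' i, b (i + N) ≤ T * ((N : ℝ) + 1) ^ (-κ)) :
    MultilevelAchieves cost c K ρ γ L a α δ (2 * (s / κ)) := by
  have ha₀ : 0 < a := by linarith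
  -- The number of points on level k will be ⌈a^{lam(m-k)}⌉. The lower bound on lam makes the error
  -- sum, and the upper bound the cost sum, geometric with the finest level dominating.
  obtain ⟨lam, hlam₁, hlam₂⟩ := exists_between
    (show κ / (2 * τ) < s by rw [div_lt_iff₀ (by positivity)]; linarith)
  have hlam₀ : 0 < lam := lt_trans (by positivity) hlam₁
  rw [div_lt_iff₀ (by positivity)] at hlam₁
  set θ := a ^ (-κ) with hθ
  set y := a ^ lam with hy
  set z := a ^ s with hz
  set ψ := y ^ (-(2 * τ)) with hψ
  have hθ₀ : 0 < θ := Real.rpow_pos_of_pos ha₀ _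
  have hθ₁ : θ < 1 := Real.rpow_lt_one_of_one_lt_of_neg ha (by linarith)
  have hy₁ : 1 < y := Real.one_lt_rpow ha hlam₀
  have hyz : y < z := Real.rpow_lt_rpow_of_exponent_lt ha hlam₂
  have hz₁ : 1 < z := hy₁.trans hyz
  have hψ₀ : 0 < ψ := Real.rpow_pos_of_pos (by linarith) _
  have hψθ : ψ < θ := by
    rw [hψ, hy, ← Real.rpow_mul ha₀.le]
    exact Real.rpow_lt_rpow_of_exponent_lt ha (by linarith)
  have htail' : ∀ k, ∑' i, b (i + levelDim L a k) ≤ T * a ^ κ * θ ^ k := by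
    intro k
    refine (htail _).trans ?_
    rw [mul_assoc]
    refine mul_le_mul_of_nonneg_left ?_ hT.le
    have h1 : a ^ k / a ≤ (levelDim L a k : ℝ) + 1 := by
      rw [div_le_iff₀ ha₀, mul_comm]
      exact pow_le_mul_levelDim_add_one hL ha k
    refine (Real.rpow_le_rpow_of_nonpos (by positivity) h1 (by linarith)).trans_eq ?_
    rw [Real.div_rpow (by positivity) ha₀.le, Real.rpow_neg ha₀.le κ, div_inv_eq_mul, mul_comm,
      hθ, ← Real.rpow_natCast, ← Real.rpow_natCast, ← Real.rpow_mul ha₀.le,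
      ← Real.rpow_mul ha₀.le, mul_comm (k : ℝ)]
  -- The first term comes from the quadrature errors, the 1 from the truncation beyond v_m.
  set T₃ := T * a ^ κ * (1 / (θ - ψ) + 1) with hT₃
  have hθψ : 0 < θ - ψ := by linarith
  have hT₃₀ : 0 < T₃ := by positivity
  -- The 4 combines two evaluations per sample point with ⌈x⌉ ≤ 2x for the number of points; 2L
  -- comes from L_{k+1} ≤ 2L a^k.
  set B₃ := 4 * (B₁ * (2 * L) ^ s) / (z - y) with hB₃
  have hzy : 0 < z - y := by linarith
  have hB₃₀ : 0 ≤ B₃ := by positivity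
  have hzθ : z = θ ^ (-(s / κ)) := by
    rw [hθ, hz, ← Real.rpow_mul ha₀.le]
    congr 1
    field_simp
  refine ⟨τ, C, hτ, hquad, (cost 0 + B₃) * max 1 (z * T₃ ^ (s / κ)), fun ε hε hε₁ => ?_⟩
  obtain ⟨m, hm₁, hm₂⟩ := exists_nat_mul_pow_le_and_pow_le hT₃₀ hθ₀ hθ₁ hzθ (by positivity) hε hε₁
  have hceil : ∀ k, k < m → y ^ (m - 1 - k) ≤ (⌈y ^ (m - (k + 1))⌉₊ : ℝ) := fun k hk => by
    rw [show m - 1 - k = m - (k + 1) by omega]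
    exact Nat.le_ceil _
  refine ⟨m, fun k => ⌈y ^ (m - k)⌉₊, ?_, ?_, fun Q hQ => ⟨?_, ?_⟩⟩
  · intro k _ l _ hkl
    exact Nat.ceil_mono (pow_le_pow_right₀ hy₁.le (by omega))
  · intro k _
    exact Nat.ceil_pos.mpr (by positivity)
  · rw [← (ENNReal.pow_right_strictMono two_ne_zero).le_iff_le, ← ENNReal.ofReal_pow hε.le]
    refine (worstCaseError_multilevelRule_sq_le hK hM hc hsum ha hb hb₁ hb₂ hC₀ hQ).trans
      (ENNReal.ofReal_le_ofReal (le_trans ?_ hm₁))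
    have h1 : ∀ k ∈ Finset.range m, (∑' i, b (i + levelDim L a k))
        * ((⌈y ^ (m - (k + 1))⌉₊ : ℕ) : ℝ) ^ (-(2 * τ))
        ≤ T * a ^ κ * (θ ^ k * ψ ^ (m - 1 - k)) := by
      intro k hk
      have hk' := Finset.mem_range.mp hk
      have h2 : ((⌈y ^ (m - (k + 1))⌉₊ : ℕ) : ℝ) ^ (-(2 * τ)) ≤ ψ ^ (m - 1 - k) := by
        refine (Real.rpow_le_rpow_of_nonpos (by positivity) (hceil k hk') (by linarith)).trans_eq ?_
        exact (Real.rpow_pow_comm (by linarith) _ _).symm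
      calc _ ≤ (T * a ^ κ * θ ^ k) * ψ ^ (m - 1 - k) :=
            mul_le_mul (htail' k) h2 (by positivity) (by positivity)
        _ = _ := by ring
    refine (add_le_add (Finset.sum_le_sum h1) (htail' m)).trans ?_
    rw [← Finset.mul_sum]
    calc _ ≤ T * a ^ κ * (θ ^ m / (θ - ψ)) + T * a ^ κ * θ ^ m := by
          gcongr
          exact sum_pow_mul_pow_le hψ₀.le hψθ m
      _ = T₃ * θ ^ m := by rw [hT₃]; ring
  · refine (nestedCost_multilevelRule_le (n := fun k => ⌈y ^ (m - k)⌉₊) hcost₀ ha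
      (fun k hk => (hQ (k + 1) ⟨by omega, by omega⟩).1)
      (fun k hk => (hQ (k + 1) ⟨by omega, by omega⟩).2.1)).trans (ENNReal.ofReal_le_ofReal ?_)
    have h1 : ∀ k ∈ Finset.range m, 2 * ((⌈y ^ (m - (k + 1))⌉₊ : ℕ) : ℝ)
        * cost (levelDim L a (k + 1)) ≤ 4 * (B₁ * (2 * L) ^ s) * (z ^ k * y ^ (m - 1 - k)) := by
      intro k hk
      have hk' := Finset.mem_range.mp hk
      have h2 : ((⌈y ^ (m - (k + 1))⌉₊ : ℕ) : ℝ) ≤ 2 * y ^ (m - 1 - k) := by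
        rw [show m - 1 - k = m - (k + 1) by omega]
        exact ceil_le_two_mul (one_le_pow₀ hy₁.le)
      have h3 : cost (levelDim L a (k + 1)) ≤ B₁ * (2 * L) ^ s * z ^ k := by
        refine (hcost _ (one_le_levelDim_succ hL ha k)).trans ?_
        rw [mul_assoc]
        refine mul_le_mul_of_nonneg_left ?_ hB₁
        refine (Real.rpow_le_rpow (by positivity) (levelDim_succ_le L ha k) hs.le).trans_eq ?_
        rw [Real.mul_rpow (by positivity) (by positivity), hz, ← Real.rpow_natCast,
          ← Real.rpow_natCast, ← Real.rpow_mul ha₀.le, ← Real.rpow_mul ha₀.le, mul_comm (k : ℝ)]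
      calc _ ≤ 2 * (2 * y ^ (m - 1 - k)) * (B₁ * (2 * L) ^ s * z ^ k) :=
            mul_le_mul (by linarith) h3 (hcost₀ _) (by positivity)
        _ = _ := by ring
    calc _ ≤ cost 0 + ∑ k ∈ Finset.range m,
          4 * (B₁ * (2 * L) ^ s) * (z ^ k * y ^ (m - 1 - k)) :=
          add_le_add_right (Finset.sum_le_sum h1) _
      _ ≤ cost 0 * z ^ m + 4 * (B₁ * (2 * L) ^ s) * (z ^ m / (z - y)) := by
          rw [← Finset.mul_sum]
          gcongr
          · exact le_mul_of_one_le_right (hcost₀ 0) (one_le_pow₀ hz₁.le)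
          · exact sum_pow_mul_pow_le (by linarith) hyz m
      _ = (cost 0 + B₃) * z ^ m := by rw [hB₃]; ring
      _ ≤ (cost 0 + B₃) * (max 1 (z * T₃ ^ (s / κ)) * ε ^ (-(2 * (s / κ)))) := by
          have := hcost₀ 0
          gcongr
      _ = _ := by ring

theorem worstCaseError_nil_ne_top (hK : Measurable (Function.uncurry K.toFun))
    (hM : Integrable (fun x => K x x) ρ) {γ : Finset ℕ → ℝ≥0}
    (hsum : Summable fun u : Finset ℕ => (γ u : ℝ) * diagonalConstant K ρ ^ u.card)
    {b : ℕ → ℝ} (hb : Summable b) (hC₀ : 0 ≤ meanConstant K ρ)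
    (hb₂ : ∀ ℓ, ∑ u ∈ (Finset.range (ℓ + 1)).powerset with ℓ ∈ u,
      (γ u : ℝ) * meanConstant K ρ ^ u.card ≤ b ℓ) :
    worstCaseError K ρ γ [] ≠ ⊤ := by
  have hs : Summable fun u : Finset ℕ => (γ u : ℝ) * meanConstant K ρ ^ u.card :=
    summable_of_sum_le (fun u => by positivity)
      (sum_finset_le_of_sum_max_le (fun u => by positivity) hb hb₂)
  have h := worstCaseError_sq hK hM hsum (Q := []) (by simp)
  have h2 : ∑' u, (γ u : ℝ≥0∞) * componentError K ρ u [] ^ 2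
      = ENNReal.ofReal (∑' u : Finset ℕ, (γ u : ℝ) * meanConstant K ρ ^ u.card) := by
    rw [ENNReal.ofReal_tsum_of_nonneg (fun u => by positivity) hs]
    refine tsum_congr fun u => ?_
    rw [componentError_nil_sq hK hM, ENNReal.ofReal_mul (γ u).coe_nonneg, ENNReal.ofReal_coe_nnreal]
  intro htop
  rw [h2, htop, ENNReal.top_pow two_ne_zero] at h
  exact ENNReal.ofReal_ne_top h.symm

end Achieves

/-! ### The achieved exponents for POD weights. -/

section Exponents

theorem summable_mul_add_one_rpow {A β : ℝ} (hβ : 1 < β) :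
    Summable fun j : ℕ => A * ((j : ℝ) + 1) ^ (-β) := by
  have h : Summable fun j : ℕ => (j : ℝ) ^ (-β) := by
    rw [Real.summable_nat_rpow, neg_lt_neg_iff]
    exact hβ
  refine Summable.mul_left _ (((summable_nat_add_iff 1).mpr h).congr fun j => ?_)
  push_cast
  rfl

/-- Both i+1 and N+1 are at most i+N+1, so each summand splits into (i+1)^{-(β-κ)} (N+1)^{-κ}, and β
- κ > 1 makes the sum over i converge. -/
theorem exists_tsum_add_rpow_le {A β κ : ℝ} (hA : 0 ≤ A) (hκ : 0 ≤ κ) (hβ : κ + 1 < β) :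
    ∃ T, 0 < T ∧ ∀ N : ℕ, ∑' i : ℕ, A * (((i + N : ℕ) : ℝ) + 1) ^ (-β)
      ≤ T * ((N : ℝ) + 1) ^ (-κ) := by
  have hs := summable_mul_add_one_rpow (A := A) (β := β - κ) (by linarith)
  refine ⟨∑' i : ℕ, A * ((i : ℝ) + 1) ^ (-(β - κ)) + 1, ?_, fun N => ?_⟩
  · have : 0 ≤ ∑' i : ℕ, A * ((i : ℝ) + 1) ^ (-(β - κ)) := tsum_nonneg fun i => by positivity
    linarith
  have hN : (0 : ℝ) ≤ N := Nat.cast_nonneg N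
  calc ∑' i : ℕ, A * (((i + N : ℕ) : ℝ) + 1) ^ (-β)
      ≤ ∑' i : ℕ, A * ((i : ℝ) + 1) ^ (-(β - κ)) * ((N : ℝ) + 1) ^ (-κ) := by
        refine Summable.tsum_le_tsum (fun i => ?_)
          ((summable_nat_add_iff N).mpr (summable_mul_add_one_rpow (by linarith)))
          (hs.mul_right _)
        have hi : (0 : ℝ) ≤ i := Nat.cast_nonneg i
        rw [show -β = -(β - κ) + -κ by ring, Real.rpow_add (by positivity), mul_assoc]
        push_cast
        gcongr ?_ * (?_ * ?_)
        · exact Real.rpow_le_rpow_of_nonpos (by positivity) (by linarith) (by linarith)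
        · exact Real.rpow_le_rpow_of_nonpos (by positivity) (by linarith) (by linarith)
    _ = (∑' i : ℕ, A * ((i : ℝ) + 1) ^ (-(β - κ))) * ((N : ℝ) + 1) ^ (-κ) := tsum_mul_right
    _ ≤ _ := by
        gcongr
        linarith

variable {E : Type} [MeasurableSpace E] {K : ScalarKernel E} {c : E} {ρ : Measure E}
  [IsProbabilityMeasure ρ]

theorem worstCaseError_nil_podWeights_ne_top (hK : Measurable (Function.uncurry K.toFun))
    (hM : Integrable (fun x => K x x) ρ) (hC₀ : 0 < meanConstant K ρ)
    {Γ g : ℕ → ℝ≥0} (hg : Antitone g) (hΓ₁ : Γ 1 = 1)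
    (hsum : Summable fun u : Finset ℕ =>
      (podWeights Γ g u : ℝ) * diagonalConstant K ρ ^ u.card)
    (hδ : 1 < decay (meanConstant K ρ) (podWeights Γ g) 1) {q C_q : ℝ}
    (hq : (q : EReal) < decay (meanConstant K ρ) (podWeights Γ g) 1) (hC_q : 0 ≤ C_q)
    (hΓ : ∀ k : ℕ, 1 ≤ k → (Γ k : ℝ) ≤ C_q * (k.factorial : ℝ) ^ q) :
    worstCaseError K ρ (podWeights Γ g) [] ≠ ⊤ := by
  obtain ⟨r, hr, hrδ⟩ := EReal.lt_iff_exists_real_btwn.mp (max_lt hδ hq)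
  have hr₁ : 1 < r := by exact_mod_cast (le_max_left _ _).trans_lt hr
  have hqr : q < r := by exact_mod_cast (le_max_right _ _).trans_lt hr
  have hgr := summable_rpow_of_lt_decay hg hΓ₁ hC₀ (by linarith) hrδ
  obtain ⟨T, hT, hTle⟩ := exists_rpow_sum_max_podWeights_le hC_q hΓ hqr hgr one_pos hr₁.le hC₀.le
  simp only [div_one, Real.rpow_one] at hTle
  obtain ⟨β, hβ₁, hβ⟩ := EReal.lt_iff_exists_real_btwn.mp hδ
  obtain ⟨A, hA, hgA⟩ := exists_le_rpow_of_lt_decay hg hΓ₁ hC₀ hβ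
  refine worstCaseError_nil_ne_top hK hM hsum (b := fun ℓ => T * (A * ((ℓ : ℝ) + 1) ^ (-β)))
    ((summable_mul_add_one_rpow (by exact_mod_cast hβ₁)).mul_left T) hC₀.le fun ℓ =>
    (hTle ℓ).trans (mul_le_mul_of_nonneg_left (hgA ℓ) hT)

/-- Multilevel algorithms achieve every exponent `p > max {1/α, 2/δ, 2s/(δ-1)}`. -/
theorem multilevelAchieves_podWeights (hK : Measurable (Function.uncurry K.toFun))
    (hM : Integrable (fun x => K x x) ρ) (hc : K c c = 0) (hC₀ : 0 < meanConstant K ρ)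
    {cost : ℕ → ℝ} (hcost_one : ∀ k, 1 ≤ cost k) (hcost_mono : Monotone cost)
    {s : ℝ} (hs : 0 ≤ s)
    (hcost : (fun k : ℕ => cost k) =O[atTop] fun k : ℕ => (k : ℝ) ^ s)
    {Γ g : ℕ → ℝ≥0} (hg : Antitone g) (hΓ₁ : Γ 1 = 1)
    (hsum : Summable fun u : Finset ℕ =>
      (podWeights Γ g u : ℝ) * diagonalConstant K ρ ^ u.card)
    (hδ : 1 < decay (meanConstant K ρ) (podWeights Γ g) 1) {q C_q : ℝ}
    (hq : (q : EReal) < decay (meanConstant K ρ) (podWeights Γ g) 1) (hC_q : 0 ≤ C_q)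
    (hΓ : ∀ k : ℕ, 1 ≤ k → (Γ k : ℝ) ≤ C_q * (k.factorial : ℝ) ^ q)
    {L : ℕ} (hL : 1 ≤ L) {a : ℝ} (ha : 1 < a) {α : ℝ}
    (hquad : WeightedErrorBound c K ρ (podWeights Γ g) L a α
      (decay (meanConstant K ρ) (podWeights Γ g) ⊤))
    {p : ℝ} (hp : 0 < p) (hpα : 1 / p < α)
    (hpδ : ((2 / p : ℝ) : EReal) < decay (meanConstant K ρ) (podWeights Γ g) 1)
    (hps : ((2 * s / p + 1 : ℝ) : EReal) < decay (meanConstant K ρ) (podWeights Γ g) 1) :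
    MultilevelAchieves cost c K ρ (podWeights Γ g) L a α
      (decay (meanConstant K ρ) (podWeights Γ g) ⊤) p := by
  have htop := decay_top_podWeights hg hΓ₁ hC₀ hδ hq hC_q hΓ
  rw [htop] at hquad ⊢
  obtain ⟨τ, hτp, hτ, C, hC⟩ := hquad (1 / p) hpα (by rwa [mul_one_div])
  have hτδ : ((2 * τ : ℝ) : EReal) < decay (meanConstant K ρ) (podWeights Γ g) 1 := by
    rcases hτ with ⟨-, rfl⟩ | ⟨-, -, -, h⟩
    · simpa using hδ
    · exact h
  have hτ₂ : 1 / 2 ≤ τ := by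
    rcases hτ with ⟨-, rfl⟩ | ⟨-, h, -, -⟩
    · exact le_rfl
    · exact h
  -- One r serves both weight sums: r > q controls the factorials, and r > 2τ > 1/2 with 2τ ≥ 1
  -- covers the exponents t = 2τ and t = 1.
  obtain ⟨r, hr, hrδ⟩ := EReal.lt_iff_exists_real_btwn.mp (max_lt hτδ hq)
  have hτr : 2 * τ < r := by exact_mod_cast (le_max_left _ _).trans_lt hr
  have hqr : q < r := by exact_mod_cast (le_max_right _ _).trans_lt hr
  have hgr := summable_rpow_of_lt_decay hg hΓ₁ hC₀ (by linarith) hrδ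
  obtain ⟨T₁, hT₁, hT₁le⟩ := exists_rpow_sum_max_podWeights_le hC_q hΓ hqr hgr
    (t := 2 * τ) (by linarith) hτr.le hC.1.le
  obtain ⟨T₂, hT₂, hT₂le⟩ := exists_rpow_sum_max_podWeights_le hC_q hΓ hqr hgr one_pos
    (by linarith) hC₀.le
  simp only [div_one, Real.rpow_one] at hT₂le
  -- The tail rate is κ = d - 1. The gap d < β < δ gives γ_ℓ = O(ℓ^{-β}) with tails of order N^{-κ}.
  obtain ⟨d, hd, hdδ⟩ := EReal.lt_iff_exists_real_btwn.mp hps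
  rw [EReal.coe_lt_coe_iff] at hd
  obtain ⟨β, hdβ, hβ⟩ := EReal.lt_iff_exists_real_btwn.mp hdδ
  rw [EReal.coe_lt_coe_iff] at hdβ
  obtain ⟨A, hA, hgA⟩ := exists_le_rpow_of_lt_decay hg hΓ₁ hC₀ hβ
  have hsp : 0 ≤ 2 * s / p := by positivity
  have hd₁ : 0 < d - 1 := by linarith
  have hsd : s ≤ (d - 1) * p / 2 := by
    have : 2 * s / p < d - 1 := by linarith
    rw [div_lt_iff₀ hp] at this
    linarith
  -- The cost exponent is raised to s' = (d-1)p/2, chosen so that 2s'/(d-1) = p. The condition κ <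
  -- 2τs' then becomes 1 < τp, which is `hτp'`.
  obtain ⟨B, hB, hcostB⟩ := exists_cost_le_rpow hcost_mono hcost_one hcost hsd (by positivity)
  obtain ⟨T, hT, htail⟩ := exists_tsum_add_rpow_le (A := max T₁ T₂ * A) (β := β) (κ := d - 1)
    (by positivity) hd₁.le (by linarith)
  have hle : ∀ ℓ : ℕ, max T₁ T₂ * (g ℓ : ℝ) ≤ max T₁ T₂ * A * ((ℓ : ℝ) + 1) ^ (-β) := fun ℓ => by
    rw [mul_assoc]
    exact mul_le_mul_of_nonneg_left (hgA ℓ) (le_max_of_le_left hT₁)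
  have hτp' : 1 < τ * p := (div_lt_iff₀ hp).mp hτp
  have key := multilevelAchieves_of_tail_le (α := α) hK hM hc hC₀.le
    (fun k => zero_le_one.trans (hcost_one k))
    (s := (d - 1) * p / 2) (by positivity) hB hcostB hsum hL ha hτ hC (by linarith)
    (b := fun ℓ => max T₁ T₂ * A * ((ℓ : ℝ) + 1) ^ (-β))
    (summable_mul_add_one_rpow (by linarith))
    (fun ℓ => (hT₁le ℓ).trans ((mul_le_mul_of_nonneg_right (le_max_left _ _)
      (g ℓ).coe_nonneg).trans (hle ℓ)))
    (fun ℓ => (hT₂le ℓ).trans ((mul_le_mul_of_nonneg_right (le_max_right _ _)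
      (g ℓ).coe_nonneg).trans (hle ℓ)))
    hd₁ (by nlinarith) hT htail
  rwa [show 2 * ((d - 1) * p / 2 / (d - 1)) = p by field_simp] at key

end Exponents

/-! ### The case distinction in s and δ. -/

theorem mainTheorem2
    (D : Set ℝ) (_hD : MeasurableSet D)
    -- the anchored kernel and the probability measure
    (K : ScalarKernel D) (hK : Measurable (Function.uncurry K.toFun))
    (c : D) (hc : K c c = 0)
    (ρ : Measure D) [IsProbabilityMeasure ρ]
    (hM : Integrable (fun x => K x x) ρ)
    (hC₀ : 0 < meanConstant K ρ)
    -- the cost function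
    (cost : ℕ → ℝ) (hcost_one : ∀ k, 1 ≤ cost k) (hcost_mono : Monotone cost)
    (s : ℝ) (hs : 0 ≤ s)
    (hcost : (fun k : ℕ => cost k) =O[atTop] fun k : ℕ => (k : ℝ) ^ s)
    -- the POD weights
    (Γ g : ℕ → ℝ≥0) (hg : Antitone g) (hΓ₀ : Γ 0 = 1) (hΓ₁ : Γ 1 = 1)
    (γ : Finset ℕ → ℝ≥0) (hγ : γ = podWeights Γ g)
    (hsum : Summable fun u : Finset ℕ => (γ u : ℝ) * diagonalConstant K ρ ^ u.card)
    (δ : EReal) (hδ : δ = decay (meanConstant K ρ) γ 1) (hδ_one : 1 < δ)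
    (q C_q : ℝ) (hq : (q : EReal) < δ) (hC_q : 0 < C_q)
    (hΓ : ∀ k : ℕ, 1 ≤ k → (Γ k : ℝ) ≤ C_q * (k.factorial : ℝ) ^ q)
    -- the levels and the level quadratures
    (L : ℕ) (hL : 1 ≤ L) (a : ℝ) (ha : 1 < a)
    (α : ℝ) (hα : 1 / 2 ≤ α)
    (hquad : WeightedErrorBound c K ρ γ L a α (decay (meanConstant K ρ) γ ⊤)) :
    ((2 * α - 1) / (2 * α) ≤ s →
      MultilevelEstablishes cost c K ρ γ L a α (decay (meanConstant K ρ) γ ⊤)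
        (max ((1 / α : ℝ) : EReal) (((2 * s : ℝ) : EReal) / (δ - 1)))) ∧
    (s < (2 * α - 1) / (2 * α) →
      (((2 * α : ℝ) : EReal) ≤ δ →
        MultilevelEstablishes cost c K ρ γ L a α (decay (meanConstant K ρ) γ ⊤)
          ((1 / α : ℝ) : EReal)) ∧
      (δ < ((2 * α : ℝ) : EReal) → ((1 / (1 - s) : ℝ) : EReal) < δ →
        MultilevelEstablishes cost c K ρ γ L a α (decay (meanConstant K ρ) γ ⊤)
          (2 / δ)) ∧
      (δ ≤ ((1 / (1 - s) : ℝ) : EReal) →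
        MultilevelEstablishes cost c K ρ γ L a α (decay (meanConstant K ρ) γ ⊤)
          (((2 * s : ℝ) : EReal) / (δ - 1)))) := by
  subst hγ
  have hα₀ : 0 < α := by linarith
  have hfin := worstCaseError_nil_podWeights_ne_top hK hM hC₀ hg hΓ₁ hsum (hδ ▸ hδ_one)
    (hδ ▸ hq) hC_q.le hΓ
  have key : ∀ b : EReal, 0 ≤ b → (∀ p : ℝ, b < p → 0 < p ∧ 1 / p < α ∧
      ((2 / p : ℝ) : EReal) < δ ∧ ((2 * s / p + 1 : ℝ) : EReal) < δ) →
      MultilevelEstablishes cost c K ρ (podWeights Γ g) L a α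
        (decay (meanConstant K ρ) (podWeights Γ g) ⊤) b := by
    intro b hb hp
    have h : ∀ p : ℝ, b < p → MultilevelAchieves cost c K ρ (podWeights Γ g) L a α
        (decay (meanConstant K ρ) (podWeights Γ g) ⊤) p := fun p hbp => by
      obtain ⟨h0, h1, h2, h3⟩ := hp p hbp
      exact multilevelAchieves_podWeights hK hM hc hC₀ hcost_one hcost_mono hs hcost hg hΓ₁ hsum
        (hδ ▸ hδ_one) (hδ ▸ hq) hC_q.le hΓ hL ha hquad h0 h1 (hδ ▸ h2) (hδ ▸ h3)
    exact ⟨nestedExponent_le_of_multilevelAchieves hfin hb h, h⟩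
  have hαs : (2 * α - 1) / (2 * α) = 1 - 1 / (2 * α) := by field_simp
  rw [hαs]
  -- All information on the weights is now contained in `key`, so δ can be treated as an arbitrary
  -- extended real number above 1.
  clear hδ hquad
  induction δ with
  | bot => exact absurd hδ_one (by simp)
  | top =>
    have htop : ∀ b : EReal, ((1 / α : ℝ) : EReal) ≤ b → ∀ p : ℝ, b < p → 0 < p ∧ 1 / p < α ∧
        ((2 / p : ℝ) : EReal) < ⊤ ∧ ((2 * s / p + 1 : ℝ) : EReal) < ⊤ := by
      intro b hb p hp
      have h1 : 1 / α < p := by exact_mod_cast hb.trans_lt hp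
      have h0 : 0 < p := lt_trans (by positivity) h1
      exact ⟨h0, (one_div_lt hα₀ h0).mp h1, EReal.coe_lt_top _, EReal.coe_lt_top _⟩
    have h0 : (0 : EReal) ≤ ((1 / α : ℝ) : EReal) := by
      exact_mod_cast (by positivity : 0 ≤ 1 / α)
    refine ⟨fun _ => key _ (h0.trans (le_max_left _ _)) (htop _ (le_max_left _ _)),
      fun _ => ⟨fun _ => key _ h0 (htop _ le_rfl), fun h => absurd h (by simp),
        fun h => absurd h (by simp)⟩⟩
  | coe d =>
    have hd : 1 < d := by exact_mod_cast hδ_one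
    have hdiv : ((2 * s : ℝ) : EReal) / ((d : EReal) - 1) = ((2 * s / (d - 1) : ℝ) : EReal) := by
      rw [← EReal.coe_one, ← EReal.coe_sub, ← EReal.coe_div]
    have hdiv₂ : (2 : EReal) / (d : EReal) = ((2 / d : ℝ) : EReal) := by
      rw [EReal.coe_div]
      rfl
    have hd₀ : 0 < d - 1 := by linarith
    -- For finite δ = d it remains to check, case by case, that b dominates the three numbers 1/α,
    -- 2/d and 2s/(d-1).
    have hreal : ∀ b : ℝ, 1 / α ≤ b → 2 / d ≤ b → 2 * s / (d - 1) ≤ b →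
        MultilevelEstablishes cost c K ρ (podWeights Γ g) L a α
        (decay (meanConstant K ρ) (podWeights Γ g) ⊤) b := by
      intro b h1 h2 h3
      have hb₀ : 0 < b := lt_of_lt_of_le (by positivity) h1
      refine key b (by exact_mod_cast hb₀.le) fun p hp => ?_
      have hp' : b < p := by exact_mod_cast hp
      have hp₀ : 0 < p := hb₀.trans hp'
      refine ⟨hp₀, (one_div_lt hα₀ hp₀).mp (h1.trans_lt hp'), ?_, ?_⟩
      · rw [EReal.coe_lt_coe_iff, div_lt_iff₀ hp₀]
        have := h2.trans_lt hp'
        rw [div_lt_iff₀ (by linarith)] at this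
        linarith
      · rw [EReal.coe_lt_coe_iff, ← lt_sub_iff_add_lt, div_lt_iff₀ hp₀]
        have := h3.trans_lt hp'
        rw [div_lt_iff₀ hd₀] at this
        linarith
    rw [hdiv, hdiv₂]
    have hα2 : 1 / (2 * α) * (2 * α) = 1 := by field_simp
    refine ⟨fun hs' => ?_, fun hs' => ⟨fun h => ?_, fun h h' => ?_, fun h => ?_⟩⟩
    · rw [← EReal.coe_strictMono.monotone.map_max]
      refine hreal _ (le_max_left _ _) ?_ (le_max_right _ _)
      rcases le_total (2 * α) d with h | h
      · refine le_max_of_le_left ?_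
        rw [div_le_div_iff₀ (by linarith) hα₀]
        linarith
      -- Here 1 - s ≤ 1/(2α) ≤ 1/d, hence d - 1 ≤ sd, which is equivalent to 2/d ≤ 2s/(d-1).
      · refine le_max_of_le_right ?_
        rw [div_le_div_iff₀ (by linarith) hd₀]
        have h1 : 1 / (2 * α) ≤ 1 / d := one_div_le_one_div_of_le (by linarith) h
        have h2 : 1 / d * d = 1 := one_div_mul_cancel (by linarith)
        nlinarith
    · have h' : 2 * α ≤ d := by exact_mod_cast h
      refine hreal _ le_rfl ?_ ?_
      · rw [div_le_div_iff₀ (by linarith) hα₀]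
        linarith
      · rw [div_le_div_iff₀ hd₀ hα₀]
        nlinarith
    · have h1 : d < 2 * α := by exact_mod_cast h
      have h2 : 1 / (1 - s) < d := by exact_mod_cast h'
      have hs₁ : 0 < 1 - s := by
        have : 0 < 1 / (2 * α) := by positivity
        linarith
      rw [div_lt_iff₀ hs₁] at h2
      refine hreal _ ?_ le_rfl ?_
      · rw [div_le_div_iff₀ hα₀ (by linarith)]
        linarith
      · rw [div_le_div_iff₀ hd₀ (by linarith)]
        linarith
    · have hs₁ : 0 < 1 - s := by
        have : 0 < 1 / (2 * α) := by positivity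
        linarith
      have h1 : d ≤ 1 / (1 - s) := by exact_mod_cast h
      rw [le_div_iff₀ hs₁] at h1
      have h2 : 2 / d ≤ 2 * s / (d - 1) := by
        rw [div_le_div_iff₀ (by linarith) hd₀]
        linarith
      refine hreal _ (le_trans ?_ h2) h2 le_rfl
      rw [div_le_div_iff₀ hα₀ (by linarith)]
      have h3 : 1 / (2 * α) < 1 - s := by linarith
      nlinarith
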